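/- Let $m\ge 3$. Throughout, a polygon with $m$ vertices is a simple closed polygon $P$ in the plane with $m$ vertices, no three consecutive of which are collinear. Fix a reference point $O$ on the boundary of $P$ (possibly a vertex). For $x\in[0,1]$ the turning function $t_P(x)$ is defined as follows. The value $t_P(0)\in[0,2\pi)$ is the angle with the $x$-axis of the edge on which the counterclockwise traversal of the boundary starts at $O$. While traversing the boundary counterclockwise from $O$, each vertex passed adds to the value the turning angle in $(-\pi,\pi)$ from the incoming to the outgoing edge (positive for left turns, negative for right turns), and $t_P(x)$ is the value after the fraction $x$ of the perimeter has been traversed. A vertex reached exactly at the fraction $x$, $0<x<1$, counts as passed; if $O$ is a vertex, the turn at $O$ is not counted, neither at the beginning nor at the end of the traversal. Then for every polygon $P$ with $m$ vertices, every reference point and every $x\in[0,1]$, $$-\left(\lfloor m/2\rfloor-1\right)\pi\;\le\; t_P(x)\;\le\;\left(\lfloor m/2\rfloor+3\right)\pi .$$ Moreover, this bound is tight: for every $\varepsilon>0$ there exist polygons $P$ and $Q$ with $m$ vertices, with suitable reference points, and values $x_P,x_Q\in[0,1]$ such that $$t_P(x_P)\ge\left(\lfloor m/2\rfloor+3\right)\pi-\varepsilon\qquad\text{and}\qquad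 t_Q(x_Q)\le-\left(\lfloor m/2\rfloor-1\right)\pi+\varepsilon .$$ -/

import Mathlib

/-!
Simple polygons in the plane (identified with `ℂ`) and their turning functions, on top of the
Mathlib structure `Polygon ℂ n` (a cyclic list of `n` vertices).
-/

noncomputable section

namespace Polygon

/-- The point of the boundary at the fraction `p.2` of the `p.1`-th edge. The end point of an edge
is counted as the initial point of the next one, so that the pairs `(i, s)` run exactly once
through one tour of the closed polygonal curve. -/
def boundaryPoint {n : ℕ} (P : Polygon ℂ n) (p : Fin n × Set.Ico (0 : ℝ) 1) : ℂ :=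
  P.edgePath ℝ p.1 (p.2 : ℝ)

/-- A polygon is simple if its boundary curve does not meet itself. -/
def IsSimple {n : ℕ} (P : Polygon ℂ n) : Prop :=
  Function.Injective P.boundaryPoint

/-- The `k`-th vertex, with the index read modulo the number of vertices. -/
def vertexAt {n : ℕ} [NeZero n] (P : Polygon ℂ n) (k : ℕ) : ℂ :=
  P (Fin.ofNat n k)

/-- The edge from the `k`-th to the `(k+1)`-st vertex, as a vector. -/
def edgeVec {n : ℕ} [NeZero n] (P : Polygon ℂ n) (k : ℕ) : ℂ :=
  P.vertexAt (k + 1) - P.vertexAt k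

/-- The signed area (shoelace formula). -/
def signedArea {n : ℕ} [NeZero n] (P : Polygon ℂ n) : ℝ :=
  (1 / 2) * ∑ k ∈ Finset.range n,
    ((P.vertexAt k).re * (P.vertexAt (k + 1)).im - (P.vertexAt (k + 1)).re * (P.vertexAt k).im)

/-- The vertices of a (simple) polygon are listed in counterclockwise order. -/
def IsCounterclockwise {n : ℕ} [NeZero n] (P : Polygon ℂ n) : Prop :=
  0 < P.signedArea

/-- The perimeter. -/
def perimeter {n : ℕ} [NeZero n] (P : Polygon ℂ n) : ℝ :=
  ∑ k ∈ Finset.range n, ‖P.edgeVec k‖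

/-- The turn made at the end of the `k`-th edge, that is, the angle from the `k`-th edge to the
`(k+1)`-st edge; it lies in `(-π, π]`, is positive for left turns and negative for right turns. -/
def turn {n : ℕ} [NeZero n] (P : Polygon ℂ n) (k : ℕ) : ℝ :=
  Complex.arg (P.edgeVec (k + 1) / P.edgeVec k)

/-- The angle in `[0, 2π)` that the `k`-th edge makes with the `x`-axis. -/
def edgeAngle {n : ℕ} [NeZero n] (P : Polygon ℂ n) (k : ℕ) : ℝ :=
  toIcoMod Real.two_pi_pos 0 (Complex.arg (P.edgeVec k))

/-- Starting at the reference point `O = P.boundaryPoint p`, the vertices are met in the order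
`v_{i+1}, v_{i+2}, …, v_{i+n}`, where `i = p.1`. This is the distance along the boundary from `O`
to the vertex `v_{i+j+1}`, for `j = 0, …, n-1`. -/
def distToVertex {n : ℕ} [NeZero n] (P : Polygon ℂ n) (p : Fin n × Set.Ico (0 : ℝ) 1)
    (j : ℕ) : ℝ :=
  ∑ l ∈ Finset.range (j + 1), ‖P.edgeVec (p.1.val + l)‖
    - (p.2 : ℝ) * ‖P.edgeVec p.1.val‖

open Classical in
/-- The turning function of `P` with reference point `O = P.boundaryPoint p`, at the fraction
`x ∈ [0, 1]` of the perimeter: the angle at `O` of the tangent with the `x`-axis, plus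
the turns at the vertices passed on the way from `O`. If `O` is itself a vertex, then the turn
at `O` at the end of the tour is not counted; thus the function has `n` steps
if `O` is a vertex and `n + 1` steps otherwise. -/
def turningFunction {n : ℕ} [NeZero n] (P : Polygon ℂ n) (p : Fin n × Set.Ico (0 : ℝ) 1)
    (x : ℝ) : ℝ :=
  P.edgeAngle p.1.val +
    ∑ j ∈ (Finset.range n).filter
        (fun j => P.distToVertex p j < P.perimeter ∧ P.distToVertex p j ≤ x * P.perimeter),
      P.turn (p.1.val + j)

end Polygon

end

/-! ### Arguments of quotients; simple closed polygonal curves -/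

section

open Complex

/-! The bound rests on the total turning: the turns of a simple counterclockwise polygon add up to
`2π`. After `J` vertices the turning function is an angle in `[0, 2π)` plus `J` turns of modulus at
most `π`. Those `J` turns also equal `2π` minus the other `m - J` turns, so their sum lies between
`max (-J, 2 - (m - J)) π` and `min (J, 2 + m - J) π`. The worst `J` on either side gives the two
bounds (`Polygon.turningFunction_bounds`).

The total turning is found by Hopf's secant argument in discrete form. Changes of direction of the
secants `v j - v i` are consistent around each cell of the index triangle (`arg_square`,
`arg_triangle`), so the turns can be pushed to the secants from one vertex. From an extreme vertex
these stay in a half plane, and the total is `±2π`, with the sign of the turn there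
(`SimpleClosed.sum_turnAt`). Counterclockwise is defined by the shoelace area, so that sign must be
matched with the sign of the area: `SimpleClosed.areaSign` does this by induction, cutting the
polygon along a diagonal.

For tightness it suffices to have polygons with `⌊m/2⌋ + 1` consecutive turns close to `π`
(`exists_hairpin`). Starting before them with an angle close to `2π` gives the upper bound; starting
after them with angle `0` gives the lower one, since the remaining turns add up to about `2π -
(⌊m/2⌋ + 1)π`. Such polygons are a flattened triangle and a flattened dart, extended by thin spikes:
each spike costs two vertices and adds one turn close to `π` to the run. -/

/-- The planar cross product. -/
def cross (z w : ℂ) : ℝ := z.re * w.im - z.im * w.re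

theorem arg_div_eq_sub {z w : ℂ} (hz : z ≠ 0) (hw : w ≠ 0)
    (h₁ : -Real.pi < arg w - arg z) (h₂ : arg w - arg z ≤ Real.pi) :
    arg (w / z) = arg w - arg z := by
  have h := arg_div_coe_angle hw hz
  rw [← Real.Angle.coe_sub, arg_coe_angle_eq_iff_eq_toReal] at h
  rw [h, Real.Angle.toReal_coe_eq_self_iff]
  exact ⟨h₁, h₂⟩

/-- In the right half plane arguments lie in `(-π/2, π/2)`, so their differences never wrap around.
The factor `c` rotates a common half plane of `z` and `w` to that position. -/
theorem arg_div_of_re_pos {c z w : ℂ} (hz : 0 < (z * c).re) (hw : 0 < (w * c).re) :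
    arg (w / z) = arg (w * c) - arg (z * c) := by
  have hz0 : z * c ≠ 0 := by rintro h; simp [h] at hz
  have hw0 : w * c ≠ 0 := by rintro h; simp [h] at hw
  have hc : c ≠ 0 := right_ne_zero_of_mul hz0
  have h1 := abs_lt.1 (abs_arg_lt_pi_div_two_iff.2 (Or.inl hz))
  have h2 := abs_arg_lt_pi_div_two_iff.2 (Or.inl hw)
  rw [abs_lt] at h2
  rw [← arg_div_eq_sub hz0 hw0 (by linarith) (by linarith), mul_div_mul_right _ _ hc]

/-- Two segments `[a, b]`, `[c, d]` that do not meet: the argument of the difference of a point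
of the second and a point of the first changes consistently around the square. -/
theorem arg_square {a b c d : ℂ}
    (h : ∀ s t : ℝ, 0 ≤ s → s ≤ 1 → 0 ≤ t → t ≤ 1 →
      a + (s : ℂ) * (b - a) ≠ c + (t : ℂ) * (d - c)) :
    arg ((d - a) / (c - a)) + arg ((d - b) / (d - a)) =
      arg ((c - b) / (c - a)) + arg ((d - b) / (c - b)) := by
  have hdis : Disjoint (segment ℝ a b) (segment ℝ c d) := by
    rw [Set.disjoint_left]
    rintro x hx hx'
    rw [segment_eq_image'] at hx hx'
    obtain ⟨s, ⟨hs0, hs1⟩, rfl⟩ := hx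
    obtain ⟨t, ⟨ht0, ht1⟩, ht⟩ := hx'
    refine h s t hs0 hs1 ht0 ht1 ?_
    simpa using ht.symm
  have hcpt : ∀ x y : ℂ, IsCompact (segment ℝ x y) := fun x y => by
    rw [segment_eq_image']
    exact isCompact_Icc.image (by fun_prop)
  -- A separating functional puts all four differences into one open half plane, where the arguments
  -- of quotients telescope.
  obtain ⟨f, u, v, hu, huv, hv⟩ := geometric_hahn_banach_compact_closed (convex_segment a b)
    (hcpt a b) (convex_segment c d) (hcpt c d).isClosed hdis
  have hf : ∀ z : ℂ, (z * (f 1 - f I * I)).re = f z := fun z => by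
    have : z = z.re • (1 : ℂ) + z.im • I := by simp [re_add_im]
    conv_rhs => rw [this, map_add, map_smul, map_smul]
    simp
  have ha := hu a (left_mem_segment ℝ a b)
  have hb := hu b (right_mem_segment ℝ a b)
  have hc := hv c (left_mem_segment ℝ c d)
  have hd := hv d (right_mem_segment ℝ c d)
  have key : ∀ x y : ℂ, f x < f y → 0 < ((y - x) * (f 1 - f I * I)).re := fun x y hxy => by
    rw [hf, map_sub]; linarith
  have hca := key a c (by linarith)
  have hcb := key b c (by linarith)
  have hda := key a d (by linarith)
  have hdb := key b d (by linarith)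
  rw [arg_div_of_re_pos hca hda, arg_div_of_re_pos hda hdb, arg_div_of_re_pos hca hcb,
    arg_div_of_re_pos hcb hdb]
  ring

theorem arg_triangle {z w : ℂ} (hz : z ≠ 0) (hw : w ≠ 0) (h : arg (w / z) ≠ Real.pi) :
    arg ((z + w) / z) + arg (w / (z + w)) = arg (w / z) := by
  set θ := arg (w / z) with hθ
  have hlt : θ < Real.pi := lt_of_le_of_ne (arg_le_pi _) h
  have hgt : -Real.pi < θ := neg_pi_lt_arg _
  have hcos : 0 < Real.cos (θ / 2) :=
    Real.cos_pos_of_mem_Ioo ⟨by linarith, by linarith⟩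
  -- Rotation by the bisector: `z * c` and `w * c` get arguments `-θ/2` and `θ/2`, both in the right
  -- half plane because `θ < π`.
  set c : ℂ := exp (-(θ / 2 : ℝ) * I) / z with hc
  have h1 : (z * c).re = Real.cos (θ / 2) := by
    rw [hc, mul_div_cancel₀ _ hz, ← ofReal_neg, exp_ofReal_mul_I_re, Real.cos_neg]
  have h2 : (w * c).re = ‖w / z‖ * Real.cos (θ / 2) := by
    have : w * c = ‖w / z‖ * exp ((θ / 2 : ℝ) * I) := by
      rw [hc, ← mul_div_assoc, mul_div_right_comm]
      conv_lhs => rw [← norm_mul_exp_arg_mul_I (w / z), ← hθ]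
      rw [mul_assoc, ← Complex.exp_add]
      congr 2
      push_cast
      ring
    rw [this, re_ofReal_mul, exp_ofReal_mul_I_re]
  have hz' : 0 < (z * c).re := by rw [h1]; exact hcos
  have hw' : 0 < (w * c).re := by
    rw [h2]; exact mul_pos (norm_pos_iff.2 (div_ne_zero hw hz)) hcos
  have hs : 0 < ((z + w) * c).re := by rw [add_mul, add_re]; linarith
  rw [hθ, arg_div_of_re_pos hz' hs, arg_div_of_re_pos hs hw', arg_div_of_re_pos hz' hw']
  ring

/-- The point at parameter `s` on the `i`-th edge of the polygonal curve with vertices `v`. -/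
noncomputable def edgePoint (v : ℕ → ℂ) (i : ℕ) (s : ℝ) : ℂ := v i + (s : ℂ) * (v (i + 1) - v i)

@[simp] theorem edgePoint_zero (v : ℕ → ℂ) (i : ℕ) : edgePoint v i 0 = v i := by
  simp [edgePoint]

@[simp] theorem edgePoint_one (v : ℕ → ℂ) (i : ℕ) : edgePoint v i 1 = v (i + 1) := by
  simp [edgePoint]

/-- A simple closed polygonal curve, given by an `n`-periodic sequence of vertices. -/
structure SimpleClosed (n : ℕ) (v : ℕ → ℂ) : Prop where
  periodic : ∀ k, v (k + n) = v k
  inj : ∀ i j s t, 0 ≤ s → s < 1 → 0 ≤ t → t < 1 → edgePoint v i s = edgePoint v j t →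
    i ≡ j [MOD n] ∧ s = t

/-- The turn from the `k`-th edge to the next one. -/
noncomputable def turnAt (v : ℕ → ℂ) (k : ℕ) : ℝ := arg ((v (k + 2) - v (k + 1)) / (v (k + 1) - v k))

/-- A vertex at which a rotated lexicographic order attains its minimum. -/
def IsLexExtreme (n : ℕ) (v : ℕ → ℂ) (k : ℕ) : Prop :=
  ∃ c : ℂ, ∀ j, ¬ j ≡ k [MOD n] →
    0 < ((v j - v k) * c).im ∨ (((v j - v k) * c).im = 0 ∧ 0 < ((v j - v k) * c).re)

namespace SimpleClosed

variable {n : ℕ} {v : ℕ → ℂ}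

theorem periodic_mul (h : SimpleClosed n v) (k m : ℕ) : v (k + m * n) = v k := by
  induction m with
  | zero => simp
  | succ m ih => rw [Nat.succ_mul, ← add_assoc, h.periodic, ih]

theorem apply_mod (h : SimpleClosed n v) (k : ℕ) : v (k % n) = v k := by
  conv_rhs => rw [← Nat.mod_add_div k n, mul_comm, h.periodic_mul]

theorem congr (h : SimpleClosed n v) {i j : ℕ} (hij : i ≡ j [MOD n]) : v i = v j := by
  rw [← h.apply_mod i, ← h.apply_mod j, hij]

theorem vertex_inj (h : SimpleClosed n v) {i j : ℕ} (hij : v i = v j) : i ≡ j [MOD n] :=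
  (h.inj i j 0 0 le_rfl one_pos le_rfl one_pos (by simpa using hij)).1

theorem shift (h : SimpleClosed n v) (r : ℕ) : SimpleClosed n (fun k => v (k + r)) where
  periodic k := by
    rw [add_right_comm, h.periodic]
  inj i j s t hs hs' ht ht' hst := by
    have := h.inj (i + r) (j + r) s t hs hs' ht ht' (by
      simpa only [edgePoint, add_right_comm _ 1 r] using hst)
    exact ⟨Nat.ModEq.add_right_cancel' r this.1, this.2⟩

theorem not_modEq_succ (hn : 2 ≤ n) (i : ℕ) : ¬ i ≡ i + 1 [MOD n] := by
  intro h
  have := (Nat.modEq_iff_dvd' (Nat.le_succ i)).1 h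
  simp at this
  omega

theorem edge_ne_zero (h : SimpleClosed n v) (hn : 2 ≤ n) (i : ℕ) : v (i + 1) - v i ≠ 0 :=
  fun h0 => not_modEq_succ hn i (h.vertex_inj (sub_eq_zero.1 h0).symm)

theorem exists_half_open (v : ℕ → ℂ) (i : ℕ) {s : ℝ} (hs : 0 ≤ s) (hs' : s ≤ 1) :
    ∃ i' s', ((i' = i ∧ s' = s) ∨ (i' = i + 1 ∧ s' = 0)) ∧ 0 ≤ s' ∧ s' < 1 ∧
      edgePoint v i s = edgePoint v i' s' := by
  rcases hs'.lt_or_eq with hlt | rfl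
  · exact ⟨i, s, Or.inl ⟨rfl, rfl⟩, hs, hlt, rfl⟩
  · exact ⟨i + 1, 0, Or.inr ⟨rfl, rfl⟩, le_rfl, one_pos, by simp⟩

theorem edgePoint_ne (h : SimpleClosed n v) {i j : ℕ} (h₁ : ¬ i ≡ j [MOD n])
    (h₂ : ¬ i + 1 ≡ j [MOD n]) (h₃ : ¬ i ≡ j + 1 [MOD n]) {s t : ℝ} (hs : 0 ≤ s) (hs' : s ≤ 1)
    (ht : 0 ≤ t) (ht' : t ≤ 1) : edgePoint v i s ≠ edgePoint v j t := by
  intro he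
  obtain ⟨i', s', hi, hi0, hi1, hie⟩ := exists_half_open v i hs hs'
  obtain ⟨j', t', hj, hj0, hj1, hje⟩ := exists_half_open v j ht ht'
  have := (h.inj i' j' s' t' hi0 hi1 hj0 hj1 (by rw [← hie, ← hje, he])).1
  rcases hi with ⟨rfl, -⟩ | ⟨rfl, -⟩ <;> rcases hj with ⟨rfl, -⟩ | ⟨rfl, -⟩
  · exact h₁ this
  · exact h₃ this
  · exact h₂ this
  · exact h₁ (Nat.ModEq.add_right_cancel' 1 this)

/-- A turn of `π` would make the next edge run back over the present one. -/
theorem turnAt_ne_pi (h : SimpleClosed n v) (hn : 2 ≤ n) (k : ℕ) : turnAt v k ≠ Real.pi := by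
  intro hk
  rw [turnAt, arg_eq_pi_iff] at hk
  have he := h.edge_ne_zero hn k
  set q := (v (k + 2) - v (k + 1)) / (v (k + 1) - v k) with hq
  have hqr : q = (q.re : ℂ) := by apply Complex.ext <;> simp [hk.2]
  set r := -q.re with hr
  have hr0 : 0 < r := by linarith [hk.1]
  have hv : v (k + 2) - v (k + 1) = -(r : ℂ) * (v (k + 1) - v k) := by
    rw [hr, ofReal_neg, neg_neg, ← hqr, hq, div_mul_cancel₀ _ he]
  have hpos : 0 < 1 + r := by linarith
  -- With the next edge equal to `-r` times the present one, the parameter `1 / (1 + r)` gives a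
  -- common point for every `r > 0`, whichever edge is longer.
  have := h.inj k (k + 1) (1 - r * (1 / (1 + r))) (1 / (1 + r)) (by
      have : r * (1 / (1 + r)) ≤ 1 := by rw [mul_one_div, div_le_one hpos]; linarith
      linarith) (by
      have : 0 < r * (1 / (1 + r)) := by positivity
      linarith) (by positivity) (by rw [div_lt_one hpos]; linarith) (by
      simp only [edgePoint, add_assoc, Nat.reduceAdd]
      rw [hv]; push_cast; ring)
  exact not_modEq_succ hn k this.1

end SimpleClosed

end

/-! ### The total turning is `±2π` -/

section

open Complex

/-- The sine-like quantity whose sign is that of the turn from the `k`-th edge to the next. -/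
def crossAt (v : ℕ → ℂ) (k : ℕ) : ℝ := cross (v (k + 1) - v k) (v (k + 2) - v (k + 1))

theorem im_div_eq_cross (z w : ℂ) : (w / z).im = cross z w / normSq z := by
  rw [div_im, cross]; ring

theorem im_div_pos_iff {z : ℂ} (hz : z ≠ 0) (w : ℂ) : 0 < (w / z).im ↔ 0 < cross z w := by
  rw [im_div_eq_cross, div_pos_iff_of_pos_right (normSq_pos.2 hz)]

theorem im_div_neg_iff {z : ℂ} (hz : z ≠ 0) (w : ℂ) : (w / z).im < 0 ↔ cross z w < 0 := by
  rw [im_div_eq_cross, div_neg_iff]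
  have := normSq_pos.2 hz
  constructor
  · rintro (⟨-, h⟩ | ⟨h, -⟩)
    · linarith
    · exact h
  · exact fun h => Or.inr ⟨h, this⟩

theorem im_pos_of_arg {z : ℂ} (h₀ : 0 < arg z) (h₁ : arg z < Real.pi) : 0 < z.im := by
  have h := arg_nonneg_iff.1 h₀.le
  refine h.lt_of_ne fun him => ?_
  rcases lt_or_ge z.re 0 with hre | hre
  · exact h₁.ne (arg_eq_pi_iff.2 ⟨hre, him.symm⟩)
  · exact h₀.ne' (arg_eq_zero_iff.2 ⟨hre, him.symm⟩)

theorem arg_pos_of_im_pos {z : ℂ} (h : 0 < z.im) : 0 < arg z :=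
  (arg_nonneg_iff.2 h.le).lt_of_ne fun h0 => h.ne' (arg_eq_zero_iff.1 h0.symm).2

theorem sum_range_shift {n : ℕ} {f : ℕ → ℝ} (hf : ∀ k, f (k + n) = f k) (r : ℕ) :
    ∑ k ∈ Finset.range n, f (k + r) = ∑ k ∈ Finset.range n, f k := by
  induction r with
  | zero => simp
  | succ r ih =>
    have h1 := Finset.sum_range_succ (fun k => f (k + r)) n
    have h2 := Finset.sum_range_succ' (fun k => f (k + r)) n
    have h3 : f (n + r) = f (0 + r) := by rw [add_comm n, hf, zero_add]
    have h4 : ∀ k, k + (r + 1) = k + 1 + r := fun k => by ring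
    simp only [h4]
    linarith

/-- Discrete Stokes: consistency around each cell gives consistency around a column of cells. -/
theorem sum_square_column (H V : ℕ → ℕ → ℝ) (r j : ℕ) (p : ℕ) (hrp : r ≤ p)
    (hcell : ∀ i, r ≤ i → i < p → H i j + V i (j + 1) = V i j + H (i + 1) j) :
    H r j + ∑ i ∈ Finset.Ico r p, V i (j + 1) = ∑ i ∈ Finset.Ico r p, V i j + H p j := by
  induction p, hrp using Nat.le_induction with
  | base => simp
  | succ p hp ih =>
    rw [Finset.sum_Ico_succ_top hp, Finset.sum_Ico_succ_top hp]
    have h1 := ih fun i hi hip => hcell i hi (hip.trans p.lt_succ_self)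
    have h2 := hcell p hp p.lt_succ_self
    linarith

theorem arg_mem_Ico_of_lex {z : ℂ} (h : 0 < z.im ∨ (z.im = 0 ∧ 0 < z.re)) :
    0 ≤ arg z ∧ arg z < Real.pi := by
  rcases h with h | ⟨h, h'⟩
  · exact ⟨arg_nonneg_iff.2 h.le, arg_lt_pi_iff.2 (Or.inr h.ne')⟩
  · exact ⟨arg_nonneg_iff.2 h.ge, arg_lt_pi_iff.2 (Or.inl h'.le)⟩

theorem arg_neg_of_arg_pos {z : ℂ} (h₀ : 0 < arg z) (h₁ : arg z < Real.pi) :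
    arg (-z) = arg z - Real.pi :=
  arg_neg_eq_arg_sub_pi_of_im_pos (im_pos_of_arg h₀ h₁)

namespace SimpleClosed

variable {n : ℕ} {v : ℕ → ℂ}

theorem not_modEq_of_lt {i j : ℕ} (hij : i < j) (hj : j < n) : ¬ i ≡ j [MOD n] := by
  intro h
  rw [Nat.ModEq, Nat.mod_eq_of_lt (hij.trans hj), Nat.mod_eq_of_lt hj] at h
  omega

theorem turnAt_periodic (h : SimpleClosed n v) (k : ℕ) : turnAt v (k + n) = turnAt v k := by
  simp only [turnAt, add_right_comm k n, h.periodic]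

/-- Hopf's argument on the grid of pairs `i < j`. `H` and `V` are the changes of direction of the
secant from `v i` to `v j` when `j`, respectively `i`, advances. The turns along the diagonal are
carried to the row `i = 0` and the column `j = N + 2`; as `v (N + 2) = v 0`, both carry the same
sum, whence the factor 2. -/
theorem sum_turnAt_eq (N : ℕ) (hN : 1 ≤ N) (h : SimpleClosed (N + 2) v) :
    ∑ k ∈ Finset.range (N + 2), turnAt v k =
      2 * ∑ j ∈ Finset.range N, arg ((v (j + 2) - v 0) / (v (j + 1) - v 0)) +
        2 * turnAt v (N + 1) := by
  set H : ℕ → ℕ → ℝ := fun i j => arg ((v (j + 1) - v i) / (v j - v i)) with hH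
  set V : ℕ → ℕ → ℝ := fun i j => arg ((v j - v (i + 1)) / (v j - v i)) with hV
  -- The corner cell is excluded: there the first and the last edge meet at `v 0`.
  have hcell : ∀ i j, i + 1 < j → j + 1 ≤ N + 2 → ¬ (i = 0 ∧ j + 1 = N + 2) →
      H i j + V i (j + 1) = V i j + H (i + 1) j := by
    intro i j hij hj hne
    refine arg_square fun s t hs hs' ht ht' => ?_
    refine h.edgePoint_ne (not_modEq_of_lt (by omega) (by omega))
      (not_modEq_of_lt hij (by omega)) ?_ hs hs' ht ht'
    rcases hj.lt_or_eq with hlt | heq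
    · exact not_modEq_of_lt (by omega) hlt
    · rw [heq]
      intro hi
      have := (Nat.modEq_zero_iff_dvd.1 (hi.trans (by simp [Nat.ModEq])))
      have := Nat.le_of_dvd (by omega) this
      omega
  have hdiag : ∀ i, turnAt v i = H i (i + 1) + V i (i + 2) := by
    intro i
    have := arg_triangle (h.edge_ne_zero (by omega) i) (h.edge_ne_zero (by omega) (i + 1))
      (h.turnAt_ne_pi (by omega) i)
    rw [show v (i + 1) - v i + (v (i + 1 + 1) - v (i + 1)) = v (i + 2) - v i by ring_nf] at this
    exact this.symm
  have hcol : ∀ r k, r ≤ k → k + 2 ≤ N + 2 → ¬ (r = 0 ∧ k + 2 = N + 2) →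
      H r (k + 1) + ∑ i ∈ Finset.Ico r (k + 1), V i (k + 2) =
        ∑ i ∈ Finset.Ico r k, V i (k + 1) + turnAt v k := by
    intro r k hrk hk hne
    have h1 := sum_square_column H V r (k + 1) k hrk fun i hi hik =>
      hcell i (k + 1) (by omega) hk (by omega)
    rw [Finset.sum_Ico_succ_top hrk, hdiag]
    linarith
  have htri : ∀ k, k ≤ N → ∑ i ∈ Finset.range k, turnAt v i =
      ∑ j ∈ Finset.range k, H 0 (j + 1) + ∑ i ∈ Finset.range k, V i (k + 1) := by
    intro k
    induction k with
    | zero => simp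
    | succ k ih =>
      intro hk
      have h1 := hcol 0 k (Nat.zero_le _) (by omega) (by omega)
      rw [← Finset.range_eq_Ico, ← Finset.range_eq_Ico] at h1
      rw [Finset.sum_range_succ, ih (by omega), Finset.sum_range_succ (fun j => H 0 (j + 1))]
      linarith
  have h1 := htri N le_rfl
  have h2 := hcol 1 N hN le_rfl (by omega)
  have hv0 : v (N + 2) = v 0 := by simpa using h.periodic 0
  have hv1 : v (N + 3) = v 1 := by
    rw [← h.periodic 1]; congr 1; ring
  -- Instead of the excluded corner cell, a triangle of secants at `v 0` supplies a second copy of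
  -- the closing turn.
  have h3 : V 0 (N + 1) + H 1 (N + 1) = turnAt v (N + 1) := by
    have hz := h.edge_ne_zero (by omega) (N + 1)
    have hw := h.edge_ne_zero (by omega) 0
    rw [add_assoc, show 1 + 1 = 2 from rfl, hv0] at hz
    have hz' : v (N + 1) - v 0 ≠ 0 := by rwa [← neg_sub, neg_ne_zero]
    have hw' : v 0 - v 1 ≠ 0 := by rwa [← neg_sub, neg_ne_zero]
    have ht : turnAt v (N + 1) = arg ((v 0 - v 1) / (v (N + 1) - v 0)) := by
      rw [turnAt]
      simp only [add_assoc, Nat.reduceAdd]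
      rw [hv0, hv1, ← neg_sub, ← neg_sub (v (N + 1)), neg_div_neg_eq]
    have := arg_triangle hz' hw' (ht ▸ h.turnAt_ne_pi (by omega) (N + 1))
    rw [← ht, sub_add_sub_cancel] at this
    rw [← this]
    simp only [hV, hH, zero_add, add_assoc, Nat.reduceAdd, hv0]
  -- Secants into `v (N + 2) = v 0` are the negatives of those out of `v 0`, and the sign cancels in
  -- the quotient.
  have h4 : ∑ i ∈ Finset.Ico 1 (N + 1), V i (N + 2) = ∑ j ∈ Finset.range N, H 0 (j + 1) := by
    rw [Finset.sum_Ico_eq_sum_range]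
    refine Finset.sum_congr rfl fun j _ => ?_
    simp only [hV, hH, hv0]
    rw [← neg_sub, ← neg_sub (v (1 + j)), neg_div_neg_eq, add_comm 1 j]
  have h5 : ∑ i ∈ Finset.range N, V i (N + 1) =
      V 0 (N + 1) + ∑ i ∈ Finset.Ico 1 N, V i (N + 1) := by
    rw [Finset.range_eq_Ico, Finset.sum_eq_sum_Ico_succ_bot (by omega)]
  rw [Finset.sum_range_succ, Finset.sum_range_succ]
  have h6 : ∑ j ∈ Finset.range N, arg ((v (j + 2) - v 0) / (v (j + 1) - v 0)) =
    ∑ j ∈ Finset.range N, H 0 (j + 1) := rfl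
  rw [h6]
  linarith

/-- Seen from an extreme vertex all others have arguments in `[0, π)` after rotation, so the secant
sum telescopes to last minus first. The closing turn is first minus last, plus or minus `π`;
doubled, only `±2π` remains. -/
theorem sum_turnAt_of_extreme_zero (N : ℕ) (hN : 1 ≤ N) (h : SimpleClosed (N + 2) v)
    (hext : IsLexExtreme (N + 2) v 0) :
    (0 < turnAt v (N + 1) ∧ ∑ k ∈ Finset.range (N + 2), turnAt v k = 2 * Real.pi) ∨
      (turnAt v (N + 1) < 0 ∧ ∑ k ∈ Finset.range (N + 2), turnAt v k = -(2 * Real.pi)) := by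
  obtain ⟨c, hc⟩ := hext
  set x : ℕ → ℂ := fun j => (v j - v 0) * c with hx
  have hlex : ∀ j, 0 < j → j < N + 2 → 0 < (x j).im ∨ ((x j).im = 0 ∧ 0 < (x j).re) :=
    fun j hj hj' => hc j fun hm => not_modEq_of_lt hj hj' hm.symm
  have hx0 : ∀ j, 0 < j → j < N + 2 → x j ≠ 0 := fun j hj hj' h0 => by
    have := hlex j hj hj'
    simp [h0] at this
  have hc0 : c ≠ 0 := right_ne_zero_of_mul (hx0 1 one_pos (by omega))
  have hmem := fun j hj hj' => arg_mem_Ico_of_lex (hlex j hj hj')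
  have hsum : ∑ j ∈ Finset.range N, arg ((v (j + 2) - v 0) / (v (j + 1) - v 0)) =
      arg (x (N + 1)) - arg (x 1) := by
    rw [← Finset.sum_range_sub (fun j => arg (x (j + 1)))]
    refine Finset.sum_congr rfl fun j hj => ?_
    have hj := Finset.mem_range.1 hj
    have h1 := hmem (j + 1) (by omega) (by omega)
    have h2 := hmem (j + 2) (by omega) (by omega)
    rw [← mul_div_mul_right _ _ hc0]
    exact arg_div_eq_sub (hx0 (j + 1) (by omega) (by omega)) (hx0 (j + 2) (by omega) (by omega))
      (by linarith) (by linarith)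
  have hv0 : v (N + 2) = v 0 := by simpa using h.periodic 0
  have hv1 : v (N + 3) = v 1 := by
    rw [← h.periodic 1]; congr 1; ring
  have hturn : turnAt v (N + 1) = arg (x 1 / -x (N + 1)) := by
    rw [turnAt]
    simp only [add_assoc, Nat.reduceAdd]
    rw [hv0, hv1, hx]
    simp only
    rw [← neg_mul, mul_div_mul_right _ _ hc0, neg_sub]
  rw [h.sum_turnAt_eq N hN, hsum]
  have h1 := hmem 1 one_pos (by omega)
  have hN1 := hmem (N + 1) (by omega) (by omega)
  have hx1 := hx0 1 one_pos (by omega)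
  have hxN := hx0 (N + 1) (by omega) (by omega)
  rcases lt_trichotomy (arg (x 1)) (arg (x (N + 1))) with hlt | heq | hgt
  · left
    have ha := arg_neg_of_arg_pos (h1.1.trans_lt hlt) hN1.2
    rw [hturn, arg_div_eq_sub (neg_ne_zero.2 hxN) hx1 (by linarith) (by linarith), ha]
    constructor <;> linarith
  -- Equal arguments mean that the two edges at `v 0` overlap, that is, a turn of `π`.
  · exfalso
    refine h.turnAt_ne_pi (by omega) (N + 1) ?_
    rw [hturn, div_neg, arg_eq_pi_iff]
    have := arg_div_eq_sub hxN hx1 (by rw [heq]; linarith [Real.pi_pos])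
      (by rw [heq]; linarith [Real.pi_pos])
    rw [heq, sub_self, arg_eq_zero_iff] at this
    simp only [neg_re, neg_im, neg_eq_zero, neg_lt_zero]
    refine ⟨this.1.lt_of_ne fun hre => ?_, this.2⟩
    exact div_ne_zero hx1 hxN (Complex.ext hre.symm this.2)
  · right
    have ha := arg_neg_of_arg_pos (hN1.1.trans_lt hgt) h1.2
    have : turnAt v (N + 1) = arg (x 1) - Real.pi - arg (x (N + 1)) := by
      rw [hturn, div_neg, ← neg_div, ← ha, arg_div_eq_sub hxN (neg_ne_zero.2 hx1) (by linarith)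
        (by linarith)]
    rw [this]
    constructor <;> linarith

theorem turnAt_pos_iff (h : SimpleClosed n v) (hn : 2 ≤ n) (k : ℕ) :
    0 < turnAt v k ↔ 0 < crossAt v k := by
  rw [crossAt, ← im_div_pos_iff (h.edge_ne_zero hn k)]
  exact ⟨fun h0 => im_pos_of_arg h0 (lt_of_le_of_ne (arg_le_pi _) (h.turnAt_ne_pi hn k)),
    arg_pos_of_im_pos⟩

theorem turnAt_neg_iff (h : SimpleClosed n v) (hn : 2 ≤ n) (k : ℕ) :
    turnAt v k < 0 ↔ crossAt v k < 0 := by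
  rw [crossAt, ← im_div_neg_iff (h.edge_ne_zero hn k)]
  exact arg_neg_iff

theorem extreme_shift {k r : ℕ} (hext : IsLexExtreme n v (k + r)) :
    IsLexExtreme n (fun j => v (j + r)) k := by
  obtain ⟨c, hc⟩ := hext
  exact ⟨c, fun j hj => hc (j + r) fun h => hj (Nat.ModEq.add_right_cancel' r h)⟩

/-- **Umlaufsatz**: the turns of a simple closed polygonal curve add up to `±2π`, with the sign
of the turn at any extreme vertex. -/
theorem sum_turnAt (h : SimpleClosed n v) (hn : 3 ≤ n) {k : ℕ}
    (hext : IsLexExtreme n v (k + 1)) :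
    (0 < crossAt v k ∧ ∑ k ∈ Finset.range n, turnAt v k = 2 * Real.pi) ∨
      (crossAt v k < 0 ∧ ∑ k ∈ Finset.range n, turnAt v k = -(2 * Real.pi)) := by
  obtain ⟨N, rfl⟩ := Nat.exists_eq_add_of_le' (show 2 ≤ n by omega)
  have := (h.shift (k + 1)).sum_turnAt_of_extreme_zero N (by omega)
    (extreme_shift (by simpa using hext))
  have hs : ∑ j ∈ Finset.range (N + 2), turnAt (fun i => v (i + (k + 1))) j =
      ∑ j ∈ Finset.range (N + 2), turnAt v j := by
    rw [← sum_range_shift h.turnAt_periodic (k + 1)]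
    refine Finset.sum_congr rfl fun j _ => ?_
    simp only [turnAt, add_right_comm]
  have ht : turnAt (fun i => v (i + (k + 1))) (N + 1) = turnAt v k := by
    rw [← h.turnAt_periodic k]
    simp only [turnAt]
    congr 4 <;> ring
  rw [hs, ht, h.turnAt_pos_iff (by omega), h.turnAt_neg_iff (by omega)] at this
  exact this

end SimpleClosed

end

/-! ### Cutting along a chord; the triangle at a vertex -/

section

open Complex

/-- The polygonal curve with vertices `v 0, …, v (N - 1)`, closed up. -/
def closeUp (N : ℕ) (v : ℕ → ℂ) (k : ℕ) : ℂ := v (k % N)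

/-- Twice the signed area enclosed by a closed polygonal curve. -/
def doubleArea (n : ℕ) (v : ℕ → ℂ) : ℝ := ∑ k ∈ Finset.range n, cross (v k) (v (k + 1))

/-- The coordinate of `x` along `v 0 - v 1` in the frame at `v 1` spanned by `v 0`, `v 2`. -/
noncomputable def coordFst (v : ℕ → ℂ) (x : ℂ) : ℝ :=
  cross (x - v 1) (v 2 - v 1) / cross (v 0 - v 1) (v 2 - v 1)

/-- The coordinate of `x` along `v 2 - v 1` in the frame at `v 1` spanned by `v 0`, `v 2`. -/
noncomputable def coordSnd (v : ℕ → ℂ) (x : ℂ) : ℝ :=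
  cross (v 0 - v 1) (x - v 1) / cross (v 0 - v 1) (v 2 - v 1)

theorem closeUp_of_lt {N : ℕ} (v : ℕ → ℂ) {k : ℕ} (hk : k < N) : closeUp N v k = v k := by
  rw [closeUp, Nat.mod_eq_of_lt hk]

theorem closeUp_self (N : ℕ) (v : ℕ → ℂ) : closeUp N v N = v 0 := by simp [closeUp]

theorem closeUp_periodic (N : ℕ) (v : ℕ → ℂ) (k : ℕ) : closeUp N v (k + N) = closeUp N v k := by
  simp [closeUp]

theorem edgePoint_mod {n : ℕ} {v : ℕ → ℂ} (hv : ∀ k, v (k + n) = v k) (i : ℕ) (s : ℝ) :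
    edgePoint v (i % n) s = edgePoint v i s := by
  have h : ∀ k m, v (k + n * m) = v k := by
    intro k m
    induction m with
    | zero => simp
    | succ m ih => rw [Nat.mul_succ, ← add_assoc, hv, ih]
  have h1 := h (i % n) (i / n)
  have h2 := h (i % n + 1) (i / n)
  rw [add_right_comm, Nat.mod_add_div] at h2
  rw [Nat.mod_add_div] at h1
  rw [edgePoint, edgePoint, h1, h2]

theorem simpleClosed_of_lt {n : ℕ} {v : ℕ → ℂ} (hn : 0 < n) (hv : ∀ k, v (k + n) = v k)
    (h : ∀ i j s t, i ≤ j → j < n → 0 ≤ s → s < 1 → 0 ≤ t → t < 1 →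
      edgePoint v i s = edgePoint v j t → i = j ∧ s = t) : SimpleClosed n v where
  periodic := hv
  inj i j s t hs hs' ht ht' he := by
    rw [← edgePoint_mod hv i, ← edgePoint_mod hv j] at he
    rcases le_total (i % n) (j % n) with hij | hij
    · exact h _ _ s t hij (Nat.mod_lt _ hn) hs hs' ht ht' he
    · have := h _ _ t s hij (Nat.mod_lt _ hn) ht ht' hs hs' he.symm
      exact ⟨this.1.symm, this.2.symm⟩

theorem doubleArea_closeUp (b : ℕ) (v : ℕ → ℂ) :
    doubleArea (b + 1) (closeUp (b + 1) v) =
      ∑ k ∈ Finset.range b, cross (v k) (v (k + 1)) + cross (v b) (v 0) := by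
  rw [doubleArea, Finset.sum_range_succ, closeUp_self, closeUp_of_lt v b.lt_succ_self]
  congr 1
  refine Finset.sum_congr rfl fun k hk => ?_
  have hk := Finset.mem_range.1 hk
  rw [closeUp_of_lt v (by omega), closeUp_of_lt v (by omega)]

/-- Cramer's rule in the frame at `v 1`. The triangle `v 0, v 1, v 2` is where both coordinates are
nonnegative with sum at most 1. -/
theorem coord_eq {v : ℕ → ℂ} (hD : cross (v 0 - v 1) (v 2 - v 1) ≠ 0) (x : ℂ) :
    x = v 1 + (coordFst v x : ℂ) * (v 0 - v 1) + (coordSnd v x : ℂ) * (v 2 - v 1) := by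
  have h1 : coordFst v x * cross (v 0 - v 1) (v 2 - v 1) = cross (x - v 1) (v 2 - v 1) :=
    div_mul_cancel₀ _ hD
  have h2 : coordSnd v x * cross (v 0 - v 1) (v 2 - v 1) = cross (v 0 - v 1) (x - v 1) :=
    div_mul_cancel₀ _ hD
  apply Complex.ext
  · apply mul_left_cancel₀ hD
    simp only [add_re, re_ofReal_mul]
    simp only [mul_add]
    rw [← mul_assoc, ← mul_assoc, mul_comm _ (coordFst v x), h1, mul_comm _ (coordSnd v x), h2]
    simp only [cross, sub_re, sub_im]
    ring
  · apply mul_left_cancel₀ hD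
    simp only [add_im, im_ofReal_mul]
    simp only [mul_add]
    rw [← mul_assoc, ← mul_assoc, mul_comm _ (coordFst v x), h1, mul_comm _ (coordSnd v x), h2]
    simp only [cross, sub_re, sub_im]
    ring

theorem coordFst_line (v : ℕ → ℂ) (p q : ℂ) (s : ℝ) :
    coordFst v (p + s * (q - p)) = coordFst v p + s * (coordFst v q - coordFst v p) := by
  simp only [coordFst, cross, sub_re, sub_im, add_re, add_im, re_ofReal_mul, im_ofReal_mul]
  ring

theorem coordSnd_line (v : ℕ → ℂ) (p q : ℂ) (s : ℝ) :
    coordSnd v (p + s * (q - p)) = coordSnd v p + s * (coordSnd v q - coordSnd v p) := by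
  simp only [coordSnd, cross, sub_re, sub_im, add_re, add_im, re_ofReal_mul, im_ofReal_mul]
  ring

theorem coordFst_edgePoint (v : ℕ → ℂ) (i : ℕ) (s : ℝ) : coordFst v (edgePoint v i s) =
    coordFst v (v i) + s * (coordFst v (v (i + 1)) - coordFst v (v i)) :=
  coordFst_line v _ _ s

theorem coordSnd_edgePoint (v : ℕ → ℂ) (i : ℕ) (s : ℝ) : coordSnd v (edgePoint v i s) =
    coordSnd v (v i) + s * (coordSnd v (v (i + 1)) - coordSnd v (v i)) :=
  coordSnd_line v _ _ s

theorem cross_self_eq_zero (z : ℂ) : cross z z = 0 := by simp [cross, mul_comm]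

theorem cross_comm (z w : ℂ) : cross z w = -cross w z := by simp only [cross]; ring

theorem coordFst_zero {v : ℕ → ℂ} (hD : cross (v 0 - v 1) (v 2 - v 1) ≠ 0) :
    coordFst v (v 0) = 1 := div_self hD

theorem coordFst_one (v : ℕ → ℂ) : coordFst v (v 1) = 0 := by simp [coordFst, cross]

theorem coordFst_two (v : ℕ → ℂ) : coordFst v (v 2) = 0 := by simp [coordFst, cross_self_eq_zero]

theorem coordSnd_zero (v : ℕ → ℂ) : coordSnd v (v 0) = 0 := by simp [coordSnd, cross_self_eq_zero]

theorem coordSnd_one (v : ℕ → ℂ) : coordSnd v (v 1) = 0 := by simp [coordSnd, cross]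

theorem coordSnd_two {v : ℕ → ℂ} (hD : cross (v 0 - v 1) (v 2 - v 1) ≠ 0) :
    coordSnd v (v 2) = 1 := div_self hD

/-- A segment leaving the first quadrant inside the half plane `x + y ≤ 1` crosses one of the
sides of the standard triangle on the axes. -/
theorem exists_crossing {A B A' B' : ℝ} (hA : 0 < A) (hB : 0 < B) (hAB : A + B ≤ 1)
    (hAB' : A' + B' ≤ 1) (h : A' < 0 ∨ B' < 0) :
    ∃ l : ℝ, 0 < l ∧ l < 1 ∧ 0 ≤ A + l * (A' - A) ∧ 0 ≤ B + l * (B' - B) ∧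
      A + l * (A' - A) + (B + l * (B' - B)) ≤ 1 ∧
      (A + l * (A' - A) = 0 ∨ B + l * (B' - B) = 0) := by
  have hc : ContinuousOn (fun l : ℝ => min (A + l * (A' - A)) (B + l * (B' - B)))
      (Set.Icc 0 1) := by fun_prop
  have := intermediate_value_Ioo' zero_le_one hc (show (0 : ℝ) ∈ _ by
    constructor
    · simpa using h
    · simpa using ⟨hA, hB⟩)
  obtain ⟨l, ⟨hl0, hl1⟩, hl⟩ := this
  have hl : min (A + l * (A' - A)) (B + l * (B' - B)) = 0 := hl
  refine ⟨l, hl0, hl1, hl ▸ min_le_left _ _, hl ▸ min_le_right _ _, ?_, ?_⟩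
  · nlinarith
  · rcases min_choice (A + l * (A' - A)) (B + l * (B' - B)) with h | h
    · exact Or.inl (h ▸ hl)
    · exact Or.inr (h ▸ hl)

namespace SimpleClosed

variable {n : ℕ} {v : ℕ → ℂ}

theorem doubleArea_shift (h : SimpleClosed n v) (r : ℕ) :
    doubleArea n (fun k => v (k + r)) = doubleArea n v := by
  have hf : ∀ k, cross (v (k + n)) (v (k + n + 1)) = cross (v k) (v (k + 1)) := fun k => by
    rw [add_right_comm, h.periodic, h.periodic]
  refine Eq.trans ?_ (sum_range_shift (f := fun k => cross (v k) (v (k + 1))) hf r)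
  simp only [doubleArea, add_right_comm]

/-- The two pieces run through the chord in opposite directions, so its contributions cancel. -/
theorem doubleArea_cut (h : SimpleClosed n v) {b : ℕ} (hb : b ≤ n) :
    doubleArea n v = doubleArea (b + 1) (closeUp (b + 1) v) +
      doubleArea (n - b + 1) (closeUp (n - b + 1) fun k => v (k + b)) := by
  rw [doubleArea_closeUp, doubleArea_closeUp, Nat.sub_add_cancel hb, zero_add,
    show v n = v 0 by simpa using h.periodic 0, cross_comm (v 0), doubleArea,
    ← Finset.sum_range_add_sum_Ico _ hb, Finset.sum_Ico_eq_sum_range]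
  simp only [add_comm b, add_right_comm _ 1 b]
  ring

/-- The chord is the only new edge, and `hchord` keeps its interior off the curve. -/
theorem cut (h : SimpleClosed n v) {b : ℕ} (hb : 1 ≤ b) (hbn : b < n)
    (hchord : ∀ (i : ℕ) (s t : ℝ), 0 ≤ s → s < 1 → 0 < t → t < 1 →
      v b + (t : ℂ) * (v 0 - v b) ≠ edgePoint v i s) :
    SimpleClosed (b + 1) (closeUp (b + 1) v) := by
  have hlt : ∀ i s, i < b → edgePoint (closeUp (b + 1) v) i s = edgePoint v i s := by
    intro i s hi
    rw [edgePoint, closeUp_of_lt v (by omega), closeUp_of_lt v (by omega), edgePoint]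
  have heq : ∀ s : ℝ, edgePoint (closeUp (b + 1) v) b s = v b + (s : ℂ) * (v 0 - v b) := by
    intro s
    rw [edgePoint, closeUp_of_lt v (by omega), closeUp_self]
  have hne : ¬ 0 ≡ b [MOD n] := not_modEq_of_lt (by omega) hbn
  refine simpleClosed_of_lt (by omega) (closeUp_periodic _ v) fun i j s t hij hj hs hs' ht ht' he => ?_
  rcases (Nat.lt_succ_iff.1 hj).lt_or_eq with hj | rfl
  · rw [hlt i s (by omega), hlt j t hj] at he
    have := h.inj i j s t hs hs' ht ht' he
    refine ⟨?_, this.2⟩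
    have h1 := this.1
    rwa [Nat.ModEq, Nat.mod_eq_of_lt (by omega), Nat.mod_eq_of_lt (by omega)] at h1
  · rcases hij.lt_or_eq with hi | rfl
    · exfalso
      rw [hlt i s hi, heq] at he
      rcases ht.lt_or_eq with ht0 | rfl
      · exact hchord i s t hs hs' ht0 ht' he.symm
      · have := (h.inj i j s 0 hs hs' le_rfl one_pos (by simpa using he)).1
        exact not_modEq_of_lt hi hbn this
    · rw [heq, heq, add_right_inj] at he
      have hc : v 0 - v i ≠ 0 := fun h0 => hne (h.vertex_inj (sub_eq_zero.1 h0))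
      exact ⟨rfl, by exact_mod_cast mul_right_cancel₀ hc he⟩

theorem cut_right (h : SimpleClosed n v) {b : ℕ} (hb : 1 ≤ b) (hbn : b < n)
    (hchord : ∀ (i : ℕ) (s t : ℝ), 0 ≤ s → s < 1 → 0 < t → t < 1 →
      v b + (t : ℂ) * (v 0 - v b) ≠ edgePoint v i s) :
    SimpleClosed (n - b + 1) (closeUp (n - b + 1) fun k => v (k + b)) := by
  refine (h.shift b).cut (by omega) (by omega) fun i s t hs hs' ht ht' he => ?_
  refine hchord (i + b) s (1 - t) hs hs' (by linarith) (by linarith) ?_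
  rw [Nat.sub_add_cancel hbn.le, show v n = v 0 by simpa using h.periodic 0, zero_add] at he
  rw [edgePoint] at he ⊢
  rw [add_right_comm i b 1, ← he]
  push_cast
  ring

/-- An edge with a point in the triangle off the two axes cannot leave it through the sides on the
axes, since these are edges `0` and `1` of the curve. The crossing parameter `r` is strictly inside
the edge, which also rules out leaving through a vertex. -/
theorem coord_nonneg_of_edge (h : SimpleClosed n v) (hD : cross (v 0 - v 1) (v 2 - v 1) ≠ 0)
    {i : ℕ} {s s' : ℝ} (hs : 0 ≤ s) (hs1 : s ≤ 1) (hs' : 0 ≤ s') (hs1' : s' ≤ 1)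
    (hA : 0 < coordFst v (edgePoint v i s)) (hB : 0 < coordSnd v (edgePoint v i s))
    (hx : coordFst v (edgePoint v i s) + coordSnd v (edgePoint v i s) ≤ 1)
    (hq : coordFst v (edgePoint v i s') + coordSnd v (edgePoint v i s') ≤ 1) :
    0 ≤ coordFst v (edgePoint v i s') ∧ 0 ≤ coordSnd v (edgePoint v i s') := by
  by_contra hcon
  have hneg : coordFst v (edgePoint v i s') < 0 ∨ coordSnd v (edgePoint v i s') < 0 := by
    rcases lt_or_ge (coordFst v (edgePoint v i s')) 0 with h1 | h1
    · exact Or.inl h1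
    · exact Or.inr (not_le.1 fun h2 => hcon ⟨h1, h2⟩)
  obtain ⟨l, hl0, hl1, ha, hb, hab, h0⟩ := exists_crossing hA hB hx hq hneg
  have hss : s ≠ s' := by rintro rfl; rcases hneg with h | h <;> linarith
  obtain ⟨r, hr⟩ : ∃ r, r = s + l * (s' - s) := ⟨_, rfl⟩
  have hr0 : 0 < r := by
    rw [hr]
    rcases hs.lt_or_eq with h1 | h1
    · nlinarith
    · have : 0 < s' := hs'.lt_of_ne (fun h2 => hss (h1.symm.trans h2))
      rw [← h1]
      nlinarith
  have hr1 : r < 1 := by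
    rw [hr]
    rcases hs1.lt_or_eq with h1 | h1
    · nlinarith
    · have : s' < 1 := hs1'.lt_of_ne (fun h2 => hss (h1.trans h2.symm))
      rw [h1]
      nlinarith
  have haeq : coordFst v (edgePoint v i s) +
      l * (coordFst v (edgePoint v i s') - coordFst v (edgePoint v i s)) =
      coordFst v (edgePoint v i r) := by
    simp only [coordFst_edgePoint]; rw [hr]; ring
  have hbeq : coordSnd v (edgePoint v i s) +
      l * (coordSnd v (edgePoint v i s') - coordSnd v (edgePoint v i s)) =
      coordSnd v (edgePoint v i r) := by
    simp only [coordSnd_edgePoint]; rw [hr]; ring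
  rw [haeq] at ha hab h0
  rw [hbeq] at hb hab h0
  have hy := coord_eq hD (edgePoint v i r)
  set a := coordFst v (edgePoint v i r)
  set b := coordSnd v (edgePoint v i r)
  rcases h0 with h0 | h0
  · rw [h0] at hy hab
    rcases (show b ≤ 1 by linarith).lt_or_eq with hb1 | hb1
    · have := (h.inj i 1 r b hr0.le hr1 hb hb1 (by rw [hy, edgePoint]; push_cast; ring)).1
      rw [coordFst_edgePoint, h.congr this, h.congr (Nat.ModEq.add_right 1 this),
        coordFst_one, coordFst_two] at hA
      simp at hA
    · have := (h.inj i 2 r 0 hr0.le hr1 le_rfl one_pos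
        (by rw [hy, edgePoint_zero, hb1]; push_cast; ring)).2
      exact hr0.ne' this
  · rw [h0] at hy hab
    rcases ha.lt_or_eq with ha0 | ha0
    · have := (h.inj i 0 r (1 - a) hr0.le hr1 (by linarith) (by linarith)
        (by rw [hy, edgePoint]; push_cast; ring)).1
      rw [coordSnd_edgePoint, h.congr this, h.congr (Nat.ModEq.add_right 1 this),
        coordSnd_one, coordSnd_zero] at hB
      simp at hB
    · have := (h.inj i 1 r 0 hr0.le hr1 le_rfl one_pos
        (by rw [hy, edgePoint_zero, ← ha0]; push_cast; ring)).2
      exact hr0.ne' this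

/-- If the curve enters the triangle `v 0, v 1, v 2`, then it has another vertex in it, at least
as far from the line `v 0, v 2`. -/
theorem exists_vertex_in_triangle (h : SimpleClosed n v) (hn : 4 ≤ n)
    (hD : cross (v 0 - v 1) (v 2 - v 1) ≠ 0) {i : ℕ} {s : ℝ} (hs : 0 ≤ s) (hs1 : s < 1)
    (hA : 0 < coordFst v (edgePoint v i s)) (hB : 0 < coordSnd v (edgePoint v i s))
    (hx : coordFst v (edgePoint v i s) + coordSnd v (edgePoint v i s) ≤ 1) :
    ∃ j, ¬ j ≡ 0 [MOD n] ∧ ¬ j ≡ 1 [MOD n] ∧ ¬ j ≡ 2 [MOD n] ∧ 0 ≤ coordFst v (v j) ∧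
      0 ≤ coordSnd v (v j) ∧ coordFst v (v j) + coordSnd v (v j) ≤
        coordFst v (edgePoint v i s) + coordSnd v (edgePoint v i s) := by
  have hi0 : ¬ i ≡ 0 [MOD n] := by
    intro hi
    rw [coordSnd_edgePoint, h.congr hi, h.congr (Nat.ModEq.add_right 1 hi),
        coordSnd_one, coordSnd_zero] at hB
    simp at hB
  have hi1 : ¬ i ≡ 1 [MOD n] := by
    intro hi
    rw [coordFst_edgePoint, h.congr hi, h.congr (Nat.ModEq.add_right 1 hi),
        coordFst_one, coordFst_two] at hA
    simp at hA
  have hp := h.coord_nonneg_of_edge hD (s' := 0) hs hs1.le le_rfl zero_le_one hA hB hx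
  have hq := h.coord_nonneg_of_edge hD (s' := 1) hs hs1.le zero_le_one le_rfl hA hB hx
  rw [edgePoint_zero] at hp
  rw [edgePoint_one] at hq
  have hsum : coordFst v (edgePoint v i s) + coordSnd v (edgePoint v i s) =
      (1 - s) * (coordFst v (v i) + coordSnd v (v i)) +
        s * (coordFst v (v (i + 1)) + coordSnd v (v (i + 1))) := by
    rw [coordFst_edgePoint, coordSnd_edgePoint]; ring
  rcases le_or_gt (coordFst v (v i) + coordSnd v (v i))
    (coordFst v (edgePoint v i s) + coordSnd v (edgePoint v i s)) with hle | hgt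
  -- The end with the smaller coordinate sum is the vertex sought, unless it is `v 2`. In that case
  -- the sums force the edge to lie on the line `v 0, v 2`, and `v 3` serves instead.
  · by_cases hi2 : i ≡ 2 [MOD n]
    · have h2 : coordFst v (v i) + coordSnd v (v i) = 1 := by
        rw [h.congr hi2, coordFst_two, coordSnd_two hD, zero_add]
      have hs0 : 0 < s := hs.lt_of_ne fun h0 => by
        rw [← h0, edgePoint_zero, h.congr hi2, coordFst_two] at hA
        exact hA.false
      have hx1 := le_antisymm hx (h2 ▸ hle)
      have hq1 : coordFst v (v (i + 1)) + coordSnd v (v (i + 1)) = 1 := by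
        rw [hx1, h2] at hsum
        apply mul_left_cancel₀ hs0.ne'
        linarith
      have hi3 : i + 1 ≡ 3 [MOD n] := Nat.ModEq.add_right 1 hi2
      have := hq hq1.le
      exact ⟨i + 1, fun h0 => not_modEq_of_lt (n := n) (show 0 < 3 by omega) (by omega) (h0.symm.trans hi3),
        fun h0 => not_modEq_of_lt (n := n) (show 1 < 3 by omega) (by omega) (h0.symm.trans hi3),
        fun h0 => not_modEq_of_lt (n := n) (show 2 < 3 by omega) (by omega) (h0.symm.trans hi3),
        this.1, this.2, by rw [hq1, hx1]⟩
    · have := hp (hle.trans hx)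
      exact ⟨i, hi0, hi1, hi2, this.1, this.2, hle⟩
  · have hlt : coordFst v (v (i + 1)) + coordSnd v (v (i + 1)) <
        coordFst v (edgePoint v i s) + coordSnd v (edgePoint v i s) := by
      nlinarith
    have := hq (hlt.le.trans hx)
    refine ⟨i + 1, fun hi => ?_, fun hi => hi0 (Nat.ModEq.add_right_cancel' 1 hi),
      fun hi => hi1 (Nat.ModEq.add_right_cancel' 1 hi), this.1, this.2, hlt.le⟩
    rw [h.congr hi, coordFst_zero hD, coordSnd_zero] at hlt
    linarith

theorem coord_pos_of_vertex (h : SimpleClosed n v) (hD : cross (v 0 - v 1) (v 2 - v 1) ≠ 0) {j : ℕ}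
    (h0 : ¬ j ≡ 0 [MOD n]) (h1 : ¬ j ≡ 1 [MOD n]) (h2 : ¬ j ≡ 2 [MOD n])
    (ha : 0 ≤ coordFst v (v j)) (hb : 0 ≤ coordSnd v (v j))
    (hab : coordFst v (v j) + coordSnd v (v j) ≤ 1) :
    0 < coordFst v (v j) ∧ 0 < coordSnd v (v j) := by
  have hy := coord_eq hD (v j)
  set a := coordFst v (v j)
  set b := coordSnd v (v j)
  refine ⟨ha.lt_of_ne fun h0' => ?_, hb.lt_of_ne fun h0' => ?_⟩
  · rw [← h0'] at hy hab
    rcases (show b ≤ 1 by linarith).lt_or_eq with hb1 | hb1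
    · exact h1 (h.inj j 1 0 b le_rfl one_pos hb hb1
        (by rw [edgePoint_zero, hy, edgePoint]; push_cast; ring)).1
    · exact h2 (h.vertex_inj (by rw [hy, hb1]; push_cast; ring))
  · rw [← h0'] at hy hab
    rcases ha.lt_or_eq with ha0 | ha0
    · exact h0 (h.inj j 0 0 (1 - a) le_rfl one_pos (by linarith) (by linarith)
        (by rw [edgePoint_zero, hy, edgePoint]; push_cast; ring)).1
    · exact h1 (h.vertex_inj (by rw [hy, ← ha0]; push_cast; ring))

end SimpleClosed

end

/-! ### The sign of the area and the sign of the total turning -/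

section

open Complex

theorem cross_eq_im_mul_conj (z w : ℂ) : cross z w = -(z * starRingEnd ℂ w).im := by
  simp only [cross, mul_im, conj_re, conj_im]; ring

namespace SimpleClosed

variable {n : ℕ} {v : ℕ → ℂ}

theorem exists_extreme (h : SimpleClosed n v) (hn : 0 < n) {c : ℂ} (hc : c ≠ 0) :
    ∃ k < n, IsLexExtreme n v k ∧ ∀ j, (v k * c).im ≤ (v j * c).im := by
  obtain ⟨k, hk, hmin⟩ := Finset.exists_min_image (Finset.range n)
    (fun j => toLex ((v j * c).im, (v j * c).re)) ⟨0, Finset.mem_range.2 hn⟩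
  have hle : ∀ j, (v k * c).im < (v j * c).im ∨
      ((v k * c).im = (v j * c).im ∧ (v k * c).re ≤ (v j * c).re) := by
    intro j
    have := hmin (j % n) (Finset.mem_range.2 (Nat.mod_lt _ hn))
    rw [h.apply_mod, Prod.Lex.toLex_le_toLex] at this
    exact this
  refine ⟨k, Finset.mem_range.1 hk, ⟨c, fun j hj => ?_⟩, fun j => ?_⟩
  · rw [sub_mul, sub_im, sub_re]
    rcases hle j with h1 | ⟨h1, h2⟩
    · exact Or.inl (sub_pos.2 h1)
    · refine Or.inr ⟨sub_eq_zero.2 h1.symm, sub_pos.2 (h2.lt_of_ne fun h3 => hj ?_)⟩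
      exact (h.vertex_inj (mul_right_cancel₀ hc (Complex.ext h3 h1))).symm
  · rcases hle j with h1 | ⟨h1, -⟩
    · exact h1.le
    · exact h1.le

theorem extreme_of_subset {N : ℕ} {w : ℕ → ℂ} {k k' : ℕ} (hext : IsLexExtreme n v k)
    (hk : w k' = v k) (hw : ∀ j, ¬ j ≡ k' [MOD N] → ∃ i, ¬ i ≡ k [MOD n] ∧ w j = v i) :
    IsLexExtreme N w k' := by
  obtain ⟨c, hc⟩ := hext
  refine ⟨c, fun j hj => ?_⟩
  obtain ⟨i, hi, hji⟩ := hw j hj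
  rw [hji, hk]
  exact hc i hi

theorem extreme_closeUp (h : SimpleClosed n v) {k N r p : ℕ} (hext : IsLexExtreme n v k)
    (hN : 0 < N) (hNn : N ≤ n) (hp : p < N) (hpk : p + r ≡ k [MOD n]) :
    IsLexExtreme N (closeUp N fun j => v (j + r)) p := by
  refine extreme_of_subset hext ?_ fun j hj => ?_
  · rw [closeUp_of_lt _ hp]
    exact h.congr hpk
  · refine ⟨j % N + r, fun hc => hj ?_, rfl⟩
    have h1 := Nat.ModEq.add_right_cancel' r (hc.trans hpk.symm)
    have h2 := Nat.mod_lt j hN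
    rw [Nat.ModEq, Nat.mod_eq_of_lt (h2.trans_le hNn), Nat.mod_eq_of_lt (hp.trans_le hNn)] at h1
    rw [Nat.ModEq, h1, Nat.mod_eq_of_lt hp]

/-- Both factors have the sign of the total turning. -/
theorem crossAt_mul_pos (h : SimpleClosed n v) (hn : 3 ≤ n) {j k : ℕ}
    (hj : IsLexExtreme n v (j + 1)) (hk : IsLexExtreme n v (k + 1)) :
    0 < crossAt v j * crossAt v k := by
  have := Real.pi_pos
  rcases h.sum_turnAt hn hj with ⟨h1, h2⟩ | ⟨h1, h2⟩ <;>
    rcases h.sum_turnAt hn hk with ⟨h3, h4⟩ | ⟨h3, h4⟩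
  · exact mul_pos h1 h3
  · linarith
  · linarith
  · exact mul_pos_of_neg_of_neg h1 h3

/-- Some side of the triangle separates `v z` from it, and a vertex extreme in the normal direction
of that side is none of the three corners. -/
theorem exists_extreme_of_not_mem_triangle (h : SimpleClosed n v) (hn : 3 ≤ n)
    (hD : cross (v 0 - v 1) (v 2 - v 1) ≠ 0) {z : ℕ}
    (hz : ¬ (0 ≤ coordFst v (v z) ∧ 0 ≤ coordSnd v (v z) ∧
      coordFst v (v z) + coordSnd v (v z) ≤ 1)) :
    ∃ k, k + 3 < n ∧ IsLexExtreme n v (k + 3) := by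
  obtain ⟨c, hc⟩ : ∃ c : ℂ, ∀ i < 3, (v z * c).im < (v i * c).im := by
    have hF : ∀ x, coordFst v x = (x * (-(starRingEnd ℂ (v 2 - v 1)) /
        (cross (v 0 - v 1) (v 2 - v 1) : ℂ))).im - (v 1 * (-(starRingEnd ℂ (v 2 - v 1)) /
        (cross (v 0 - v 1) (v 2 - v 1) : ℂ))).im := by
      intro x
      rw [← sub_im, ← sub_mul, ← mul_div_assoc, div_ofReal_im, mul_neg, neg_im,
        ← cross_eq_im_mul_conj, coordFst]
    have hS : ∀ x, coordSnd v x = (x * ((starRingEnd ℂ (v 0 - v 1)) /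
        (cross (v 0 - v 1) (v 2 - v 1) : ℂ))).im - (v 1 * ((starRingEnd ℂ (v 0 - v 1)) /
        (cross (v 0 - v 1) (v 2 - v 1) : ℂ))).im := by
      intro x
      rw [← sub_im, ← sub_mul, ← mul_div_assoc, div_ofReal_im, coordSnd, cross_comm,
        cross_eq_im_mul_conj, neg_neg]
    have h00 := coordFst_zero hD
    have h01 := coordFst_one v
    have h02 := coordFst_two v
    have h10 := coordSnd_zero v
    have h11 := coordSnd_one v
    have h12 := coordSnd_two hD
    rw [hF] at h00 h01 h02
    rw [hS] at h10 h11 h12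
    rw [hF, hS] at hz
    set c₁ : ℂ := -(starRingEnd ℂ (v 2 - v 1)) / (cross (v 0 - v 1) (v 2 - v 1) : ℂ)
    set c₂ : ℂ := (starRingEnd ℂ (v 0 - v 1)) / (cross (v 0 - v 1) (v 2 - v 1) : ℂ)
    by_cases hz1 : 0 ≤ (v z * c₁).im - (v 1 * c₁).im
    · by_cases hz2 : 0 ≤ (v z * c₂).im - (v 1 * c₂).im
      · have hz3 := not_le.1 fun h3 => hz ⟨hz1, hz2, h3⟩
        refine ⟨-(c₁ + c₂), fun i hi => ?_⟩
        simp only [mul_neg, neg_im, mul_add, add_im]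
        interval_cases i <;> linarith
      · refine ⟨c₂, fun i hi => ?_⟩
        interval_cases i <;> linarith
    · refine ⟨c₁, fun i hi => ?_⟩
      interval_cases i <;> linarith
  have hc0 : c ≠ 0 := by
    rintro rfl
    simpa using hc 0 (by omega)
  obtain ⟨k, hk, hext, hmin⟩ := h.exists_extreme (by omega) hc0
  have : 3 ≤ k := by
    by_contra hk3
    exact absurd (hmin z) (not_le.2 (hc k (by omega)))
  obtain ⟨l, rfl⟩ := Nat.exists_eq_add_of_le' this
  exact ⟨l, hk, hext⟩

/-- The statement that the orientation given by the area agrees with the turns at extreme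
vertices, for curves with `n` vertices. -/
def AreaSign (n : ℕ) : Prop :=
  ∀ v, SimpleClosed n v → ∀ k, IsLexExtreme n v (k + 1) → 0 < doubleArea n v * crossAt v k

/-- The vertex of the triangle farthest from the line `v 0, v 2` is joined to `v 1` by a diagonal.
In both pieces `v 1` stays extreme and its turn keeps its sign, so both areas get the sign of
`crossAt v 0`. -/
theorem areaSign_of_chord (hn : 4 ≤ n) (ih : ∀ N, 3 ≤ N → N < n → AreaSign N)
    (h : SimpleClosed n v) (hext : IsLexExtreme n v 1)
    (hD : cross (v 0 - v 1) (v 2 - v 1) ≠ 0) {z : ℕ} (hz : z + 3 < n)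
    (ha : 0 < coordFst v (v (z + 3))) (hb : 0 < coordSnd v (v (z + 3)))
    (hab : coordFst v (v (z + 3)) + coordSnd v (v (z + 3)) ≤ 1)
    (hmin : ∀ j, ¬ j ≡ 0 [MOD n] → ¬ j ≡ 1 [MOD n] → ¬ j ≡ 2 [MOD n] → 0 ≤ coordFst v (v j) →
      0 ≤ coordSnd v (v j) → coordFst v (v (z + 3)) + coordSnd v (v (z + 3)) ≤
        coordFst v (v j) + coordSnd v (v j)) :
    0 < doubleArea n v * crossAt v 0 := by
  have hchord : ∀ (i : ℕ) (s t : ℝ), 0 ≤ s → s < 1 → 0 < t → t < 1 →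
      v (z + 2 + 1) + (t : ℂ) * (v (0 + 1) - v (z + 2 + 1)) ≠
        edgePoint (fun k => v (k + 1)) i s := by
    intro i s t hs hs' ht ht' he
    have he : v (z + 3) + (t : ℂ) * (v 1 - v (z + 3)) = edgePoint v (i + 1) s := he
    have h1 := coordFst_line v (v (z + 3)) (v 1) t
    have h2 := coordSnd_line v (v (z + 3)) (v 1) t
    rw [coordFst_one, he] at h1
    rw [coordSnd_one, he] at h2
    have h1' : coordFst v (edgePoint v (i + 1) s) = (1 - t) * coordFst v (v (z + 3)) := by
      rw [h1]; ring
    have h2' : coordSnd v (edgePoint v (i + 1) s) = (1 - t) * coordSnd v (v (z + 3)) := by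
      rw [h2]; ring
    -- A curve point on the open chord has coordinate sum `(1 - t)(a + b)`, and would yield a vertex
    -- with a sum below the minimum `a + b`.
    obtain ⟨j, hj0, hj1, hj2, hja, hjb, hjab⟩ := h.exists_vertex_in_triangle hn hD hs hs'
      (by rw [h1']; exact mul_pos (by linarith) ha) (by rw [h2']; exact mul_pos (by linarith) hb)
      (by rw [h1', h2']; nlinarith)
    have := hmin j hj0 hj1 hj2 hja hjb
    rw [h1', h2'] at hjab
    nlinarith
  have hs := h.shift 1
  have hc1 := hs.cut (b := z + 2) (by omega) (by omega) hchord
  have hc2 := hs.cut_right (b := z + 2) (by omega) (by omega) hchord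
  have harea := hs.doubleArea_cut (b := z + 2) (by omega)
  rw [h.doubleArea_shift] at harea
  obtain ⟨m, rfl⟩ : ∃ m, n = z + 4 + m := ⟨n - (z + 4), by omega⟩
  rw [show z + 4 + m - (z + 2) + 1 = m + 3 by omega] at hc2 harea
  have hv0 : v (z + m + 4) = v 0 := by
    rw [← h.periodic 0]; congr 1; ring
  have hv1 : v (z + m + 5) = v 1 := by
    rw [← h.periodic 1]; congr 1; ring
  have hext' : IsLexExtreme (z + 4 + m) (fun k => v (k + 1)) 0 := extreme_shift hext
  have e1 := hs.extreme_closeUp (r := 0) (N := z + 3) (p := 0) hext' (by omega) (by omega)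
    (by omega) (Nat.ModEq.refl _)
  have e2 := hs.extreme_closeUp (r := z + 2) (N := m + 3) (p := m + 2) hext' (by omega) (by omega)
    (by omega) (by
      rw [show m + 2 + (z + 2) = z + 4 + m by ring]
      simp [Nat.ModEq])
  -- The extreme vertex has index `0`; `AreaSign` needs an index of the form `k + 1`, hence the full
  -- period `z + 3`.
  have e1' : IsLexExtreme (z + 3) (closeUp (z + 3) fun k => v (k + 1)) (z + 2 + 1) := by
    obtain ⟨c, hc⟩ := e1
    refine ⟨c, fun j hj => ?_⟩
    rw [closeUp_self]
    exact hc j fun h0 => hj (h0.trans (by simp [Nat.ModEq]))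
  have s1 := ih (z + 3) (by omega) (by omega) _ hc1 _ e1'
  have s2 := ih (m + 3) (by omega) (by omega) _ hc2 (m + 1) e2
  have hzeq := coord_eq hD (v (z + 3))
  set a := coordFst v (v (z + 3))
  set b := coordSnd v (v (z + 3))
  have hcross : crossAt v 0 = -cross (v 0 - v 1) (v 2 - v 1) := by
    simp only [crossAt, cross, sub_re, sub_im]; ring
  have k1 : crossAt (closeUp (z + 3) fun k => v (k + 1)) (z + 2) = a * crossAt v 0 := by
    rw [crossAt, closeUp_of_lt _ (show z + 2 < z + 3 by omega), closeUp_self,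
      show z + 2 + 2 = 1 + (z + 3) by ring, closeUp_periodic,
      closeUp_of_lt _ (show 1 < z + 3 by omega), hcross]
    simp only [add_assoc, Nat.reduceAdd, zero_add]
    rw [hzeq]
    simp only [cross, sub_re, sub_im, add_re, add_im, re_ofReal_mul, im_ofReal_mul]
    ring
  have k2 : crossAt (closeUp (m + 3) fun k => v (k + (z + 2) + 1)) (m + 1) = b * crossAt v 0 := by
    rw [crossAt, closeUp_of_lt _ (show m + 1 < m + 3 by omega),
      closeUp_of_lt _ (show m + 1 + 1 < m + 3 by omega), show m + 1 + 2 = m + 3 by ring,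
      closeUp_self, hcross, show m + 1 + (z + 2) + 1 = z + m + 4 by ring,
      show m + 1 + 1 + (z + 2) + 1 = z + m + 5 by ring, hv0, hv1,
      show 0 + (z + 2) + 1 = z + 3 by ring, hzeq]
    simp only [cross, sub_re, sub_im, add_re, add_im, re_ofReal_mul, im_ofReal_mul]
    ring
  rw [k1, mul_left_comm] at s1
  rw [k2, mul_left_comm] at s2
  have p1 := pos_of_mul_pos_right s1 ha.le
  have p2 := pos_of_mul_pos_right s2 hb.le
  rw [harea, add_mul]
  exact add_pos p1 p2

/-- With no further vertex in the triangle, it can be cut off along `v 0, v 2`; its doubled area is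
`crossAt v 0`. The vertex `v 1` is lost, so the sign passes to the rest through another extreme
vertex, one whose turn the cut does not change. -/
theorem areaSign_of_ear (hn : 4 ≤ n) (ih : ∀ N, 3 ≤ N → N < n → AreaSign N)
    (h : SimpleClosed n v) (hext : IsLexExtreme n v 1)
    (hD : cross (v 0 - v 1) (v 2 - v 1) ≠ 0)
    (hempty : ∀ j, ¬ j ≡ 0 [MOD n] → ¬ j ≡ 1 [MOD n] → ¬ j ≡ 2 [MOD n] →
      ¬ (0 ≤ coordFst v (v j) ∧ 0 ≤ coordSnd v (v j) ∧
        coordFst v (v j) + coordSnd v (v j) ≤ 1)) :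
    0 < doubleArea n v * crossAt v 0 := by
  have hchord : ∀ (i : ℕ) (s t : ℝ), 0 ≤ s → s < 1 → 0 < t → t < 1 →
      v 2 + (t : ℂ) * (v 0 - v 2) ≠ edgePoint v i s := by
    intro i s t hs hs' ht ht' he
    have h1 := coordFst_line v (v 2) (v 0) t
    have h2 := coordSnd_line v (v 2) (v 0) t
    rw [coordFst_two, coordFst_zero hD, he] at h1
    rw [coordSnd_two hD, coordSnd_zero, he] at h2
    obtain ⟨j, hj0, hj1, hj2, hja, hjb, hjab⟩ := h.exists_vertex_in_triangle hn hD hs hs'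
      (by rw [h1]; linarith) (by rw [h2]; linarith) (by rw [h1, h2]; linarith)
    exact hempty j hj0 hj1 hj2 ⟨hja, hjb, by rw [h1, h2] at hjab; linarith⟩
  have hc := h.cut_right (b := 2) (by omega) (by omega) hchord
  have harea := h.doubleArea_cut (b := 2) (by omega)
  obtain ⟨k, hk, hkext⟩ := h.exists_extreme_of_not_mem_triangle (by omega) hD
    (hempty 3 (fun h0 => not_modEq_of_lt (n := n) (show 0 < 3 by omega) (by omega) h0.symm)
      (fun h0 => not_modEq_of_lt (n := n) (show 1 < 3 by omega) (by omega) h0.symm)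
      (fun h0 => not_modEq_of_lt (n := n) (show 2 < 3 by omega) (by omega) h0.symm))
  obtain ⟨m, rfl⟩ : ∃ m, n = k + 4 + m := ⟨n - (k + 4), by omega⟩
  rw [show k + 4 + m - 2 + 1 = k + m + 3 by omega] at hc harea
  have e := h.extreme_closeUp (r := 2) (N := k + m + 3) (p := k + 1) hkext (by omega) (by omega)
    (by omega) (Nat.ModEq.refl _)
  have s1 := ih (k + m + 3) (by omega) (by omega) _ hc k e
  have s2 := h.crossAt_mul_pos (by omega) (j := k + 2) (k := 0) hkext hext
  have k1 : crossAt (closeUp (k + m + 3) fun j => v (j + 2)) k = crossAt v (k + 2) := by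
    rw [crossAt, closeUp_of_lt _ (show k < k + m + 3 by omega),
      closeUp_of_lt _ (show k + 1 < k + m + 3 by omega),
      closeUp_of_lt _ (show k + 2 < k + m + 3 by omega), crossAt]
  have hA : doubleArea (2 + 1) (closeUp (2 + 1) v) = crossAt v 0 := by
    rw [doubleArea_closeUp]
    simp only [Finset.sum_range_succ, Finset.sum_range_zero, crossAt, cross, sub_re, sub_im,
      Nat.reduceAdd, zero_add]
    ring
  rw [k1] at s1
  rw [hA] at harea
  rw [harea, add_mul]
  have hsq : 0 ≤ crossAt v 0 * crossAt v 0 := mul_self_nonneg _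
  have : 0 < doubleArea (k + m + 3) (closeUp (k + m + 3) fun j => v (j + 2)) * crossAt v 0 := by
    rcases pos_and_pos_or_neg_and_neg_of_mul_pos s2 with ⟨h1, h2⟩ | ⟨h1, h2⟩
    · exact mul_pos (pos_of_mul_pos_left s1 h1.le) h2
    · exact mul_pos_of_neg_of_neg (neg_of_mul_pos_left s1 h1.le) h2
  linarith

theorem areaSign (hn : 3 ≤ n) : AreaSign n := by
  induction n using Nat.strong_induction_on with
  | _ n ih =>
  have ih' : ∀ N, 3 ≤ N → N < n → AreaSign N := fun N h3 hN => ih N hN h3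
  suffices H : ∀ v, SimpleClosed n v → IsLexExtreme n v 1 → 0 < doubleArea n v * crossAt v 0 by
    intro v h k hext
    have := H _ (h.shift k) (extreme_shift (by rwa [add_comm]))
    rw [h.doubleArea_shift] at this
    simpa [crossAt, add_comm _ k] using this
  intro v h hext
  have hc0 : crossAt v 0 ≠ 0 := by
    rcases h.sum_turnAt hn (k := 0) hext with ⟨h1, -⟩ | ⟨h1, -⟩
    · exact h1.ne'
    · exact h1.ne
  have hcross : crossAt v 0 = -cross (v 0 - v 1) (v 2 - v 1) := by
    simp only [crossAt, cross, sub_re, sub_im]; ring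
  have hD : cross (v 0 - v 1) (v 2 - v 1) ≠ 0 := fun h0 => hc0 (by rw [hcross, h0, neg_zero])
  rcases hn.lt_or_eq with hn4 | rfl
  · classical
    set S := (Finset.range n).filter fun j => 3 ≤ j ∧ 0 ≤ coordFst v (v j) ∧
      0 ≤ coordSnd v (v j) ∧ coordFst v (v j) + coordSnd v (v j) ≤ 1 with hS
    have hmem : ∀ j, ¬ j ≡ 0 [MOD n] → ¬ j ≡ 1 [MOD n] → ¬ j ≡ 2 [MOD n] →
        0 ≤ coordFst v (v j) → 0 ≤ coordSnd v (v j) →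
        coordFst v (v j) + coordSnd v (v j) ≤ 1 → j % n ∈ S := by
      intro j h0 h1 h2 ha hb hab
      rw [hS, Finset.mem_filter, Finset.mem_range, h.apply_mod]
      refine ⟨Nat.mod_lt _ (by omega), ?_, ha, hb, hab⟩
      rw [Nat.ModEq, Nat.mod_eq_of_lt (show 0 < n by omega)] at h0
      rw [Nat.ModEq, Nat.mod_eq_of_lt (show 1 < n by omega)] at h1
      rw [Nat.ModEq, Nat.mod_eq_of_lt (show 2 < n by omega)] at h2
      omega
    rcases S.eq_empty_or_nonempty with hE | hE
    · refine areaSign_of_ear hn4 ih' h hext hD fun j h0 h1 h2 ⟨ha, hb, hab⟩ => ?_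
      have := hmem j h0 h1 h2 ha hb hab
      simp [hE] at this
    · obtain ⟨z, hz, hzmin⟩ := S.exists_min_image
        (fun j => coordFst v (v j) + coordSnd v (v j)) hE
      rw [hS, Finset.mem_filter, Finset.mem_range] at hz
      obtain ⟨hzn, hz3, hza, hzb, hzab⟩ := hz
      obtain ⟨y, rfl⟩ := Nat.exists_eq_add_of_le' hz3
      have hpos := h.coord_pos_of_vertex hD
        (fun h0 => not_modEq_of_lt (n := n) (show 0 < y + 3 by omega) hzn h0.symm)
        (fun h0 => not_modEq_of_lt (n := n) (show 1 < y + 3 by omega) hzn h0.symm)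
        (fun h0 => not_modEq_of_lt (n := n) (show 2 < y + 3 by omega) hzn h0.symm) hza hzb hzab
      refine areaSign_of_chord hn4 ih' h hext hD hzn hpos.1 hpos.2 hzab
        fun j h0 h1 h2 ha hb => ?_
      rcases le_or_gt (coordFst v (v j) + coordSnd v (v j)) 1 with hle | hgt
      · have := hzmin _ (hmem j h0 h1 h2 ha hb hle)
        rwa [h.apply_mod] at this
      · exact hzab.trans hgt.le
  · have hv : v 3 = v 0 := by simpa using h.periodic 0
    have hA : doubleArea 3 v = crossAt v 0 := by
      simp only [doubleArea, Finset.sum_range_succ, Finset.sum_range_zero, crossAt, cross, sub_re,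
        sub_im, Nat.reduceAdd, zero_add, hv]
      ring
    rw [hA]
    exact mul_self_pos.2 hc0

/-- The turns of a simple closed polygonal curve of positive area add up to `2π`. -/
theorem sum_turnAt_of_doubleArea_pos (h : SimpleClosed n v) (hn : 3 ≤ n)
    (hA : 0 < doubleArea n v) : ∑ k ∈ Finset.range n, turnAt v k = 2 * Real.pi := by
  -- The shift makes the index of the extreme vertex a successor.
  obtain ⟨k, -, hk, -⟩ := (h.shift 1).exists_extreme (by omega) one_ne_zero
  have hk' : IsLexExtreme n v (k + 1) := by
    obtain ⟨c, hc⟩ := hk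
    refine ⟨c, fun j hj => ?_⟩
    have := hc (j + (n - 1)) fun h0 => hj <| by
      have := Nat.ModEq.add_right 1 h0
      rw [add_assoc, Nat.sub_add_cancel (by omega)] at this
      exact (show j ≡ j + n [MOD n] by simp [Nat.ModEq]).trans this
    simp only at this
    rwa [add_assoc, Nat.sub_add_cancel (by omega), h.periodic] at this
  rcases h.sum_turnAt hn hk' with h1 | h1
  · exact h1.2
  · have := areaSign hn v h k hk'
    linarith [mul_neg_of_pos_of_neg hA h1.1]

end SimpleClosed

end

/-! ### The bounds for the turning function -/

section

open Complex

theorem exists_filter_range_eq (n : ℕ) (p : ℕ → Prop) [DecidablePred p]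
    (hp : ∀ i j, i ≤ j → p j → p i) :
    ∃ J ≤ n, (Finset.range n).filter p = Finset.range J := by
  induction n with
  | zero => exact ⟨0, le_rfl, by simp⟩
  | succ n ih =>
    by_cases h : p n
    · refine ⟨n + 1, le_rfl, Finset.filter_true_of_mem fun i hi => ?_⟩
      exact hp i n (Nat.lt_succ_iff.1 (Finset.mem_range.1 hi)) h
    · obtain ⟨J, hJ, hJe⟩ := ih
      exact ⟨J, hJ.trans n.le_succ, by rw [Finset.range_add_one, Finset.filter_insert, if_neg h, hJe]⟩

namespace Polygon

variable {n : ℕ} [NeZero n] (P : Polygon ℂ n)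

theorem vertexAt_add_self (k : ℕ) : P.vertexAt (k + n) = P.vertexAt k := by
  have : Fin.ofNat n (k + n) = Fin.ofNat n k := Fin.ext (by simp [Fin.ofNat])
  rw [vertexAt, vertexAt, this]

theorem vertexAt_val (i : Fin n) : P.vertexAt i.val = P i := by
  rw [vertexAt]
  congr 1
  exact Fin.ext (by simp [Fin.ofNat, Nat.mod_eq_of_lt i.2])

theorem vertexAt_val_succ (i : Fin n) : P.vertexAt (i.val + 1) = P (finRotate n i) := by
  rw [vertexAt]
  congr 1
  obtain ⟨m, rfl⟩ := Nat.exists_eq_succ_of_ne_zero (NeZero.ne n)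
  rw [finRotate_apply]
  exact Fin.ext (by simp [Fin.ofNat, Fin.val_add])

theorem boundaryPoint_eq (p : Fin n × Set.Ico (0 : ℝ) 1) :
    P.boundaryPoint p = edgePoint P.vertexAt p.1.val p.2 := by
  rw [boundaryPoint, edgePath, AffineMap.lineMap_apply, edgePoint, vertexAt_val, vertexAt_val_succ]
  simp [add_comm]

theorem isSimple_iff : P.IsSimple ↔ SimpleClosed n P.vertexAt := by
  have hn : 0 < n := NeZero.pos n
  constructor
  · intro h
    refine simpleClosed_of_lt hn P.vertexAt_add_self fun i j s t hij hj hs hs' ht ht' he => ?_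
    have := @h (⟨i, hij.trans_lt hj⟩, ⟨s, hs, hs'⟩) (⟨j, hj⟩, ⟨t, ht, ht'⟩) (by
      simpa only [boundaryPoint_eq] using he)
    exact ⟨congrArg (fun x => x.1.val) this, congrArg (fun x => (x.2 : ℝ)) this⟩
  · rintro h ⟨i, s, hs, hs'⟩ ⟨j, t, ht, ht'⟩ he
    rw [boundaryPoint_eq, boundaryPoint_eq] at he
    have := h.inj i.val j.val s t hs hs' ht ht' he
    have h1 := this.1
    rw [Nat.ModEq, Nat.mod_eq_of_lt i.2, Nat.mod_eq_of_lt j.2] at h1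
    simp [Fin.ext h1, this.2]

theorem signedArea_eq : P.signedArea = 1 / 2 * doubleArea n P.vertexAt := by
  simp only [signedArea, doubleArea, cross]
  congr 1
  exact Finset.sum_congr rfl fun k _ => by ring

theorem turn_eq (k : ℕ) : P.turn k = turnAt P.vertexAt k := rfl

theorem distToVertex_mono (p : Fin n × Set.Ico (0 : ℝ) 1) : Monotone (P.distToVertex p) := by
  intro i j hij
  rw [distToVertex, distToVertex]
  gcongr

/-- Distances increase along the tour, so the vertices passed form an initial segment. -/
theorem turningFunction_eq (p : Fin n × Set.Ico (0 : ℝ) 1) (x : ℝ) :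
    ∃ J ≤ n, P.turningFunction p x =
      P.edgeAngle p.1.val + ∑ j ∈ Finset.range J, P.turn (p.1.val + j) := by
  classical
  obtain ⟨J, hJ, hJe⟩ := exists_filter_range_eq n
    (fun j => P.distToVertex p j < P.perimeter ∧ P.distToVertex p j ≤ x * P.perimeter)
    (fun i j hij h => ⟨(P.distToVertex_mono p hij).trans_lt h.1,
      (P.distToVertex_mono p hij).trans h.2⟩)
  refine ⟨J, hJ, ?_⟩
  rw [turningFunction, ← hJe]

theorem edgeAngle_nonneg (k : ℕ) : 0 ≤ P.edgeAngle k :=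
  (toIcoMod_mem_Ico Real.two_pi_pos 0 _).1

theorem edgeAngle_lt (k : ℕ) : P.edgeAngle k < 2 * Real.pi := by
  have := (toIcoMod_mem_Ico Real.two_pi_pos 0 (arg (P.edgeVec k))).2
  rwa [zero_add] at this

theorem sum_turn_add (hn : 3 ≤ n) (hs : P.IsSimple) (hc : P.IsCounterclockwise) (i : ℕ) :
    ∑ j ∈ Finset.range n, P.turn (i + j) = 2 * Real.pi := by
  have h := P.isSimple_iff.1 hs
  have hA : 0 < doubleArea n P.vertexAt := by
    have := hc
    rw [IsCounterclockwise, signedArea_eq] at this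
    linarith
  rw [← h.sum_turnAt_of_doubleArea_pos hn hA, ← sum_range_shift h.turnAt_periodic i]
  simp only [turn_eq, add_comm i]

theorem abs_sum_turn_le (i : ℕ) (s : Finset ℕ) :
    |∑ j ∈ s, P.turn (i + j)| ≤ s.card * Real.pi := by
  refine (Finset.abs_sum_le_sum_abs _ _).trans ?_
  rw [← nsmul_eq_mul]
  exact Finset.sum_le_card_nsmul _ _ _ fun j _ => abs_arg_le_pi _

theorem turningFunction_bounds (hn : 3 ≤ n) (hs : P.IsSimple) (hc : P.IsCounterclockwise)
    (p : Fin n × Set.Ico (0 : ℝ) 1) (x : ℝ) :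
    -(((n / 2 : ℕ) : ℝ) - 1) * Real.pi ≤ P.turningFunction p x ∧
      P.turningFunction p x ≤ (((n / 2 : ℕ) : ℝ) + 3) * Real.pi := by
  obtain ⟨J, hJ, hJe⟩ := P.turningFunction_eq p x
  rw [hJe]
  have h0 := P.edgeAngle_nonneg p.1.val
  have h1 := P.edgeAngle_lt p.1.val
  have htot := P.sum_turn_add hn hs hc p.1.val
  rw [← Finset.sum_range_add_sum_Ico _ hJ] at htot
  have ha := P.abs_sum_turn_le p.1.val (Finset.range J)
  have hb := P.abs_sum_turn_le p.1.val (Finset.Ico J n)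
  rw [Finset.card_range, abs_le] at ha
  rw [Nat.card_Ico, Nat.cast_sub hJ, abs_le] at hb
  have hpi := Real.pi_pos
  constructor
  -- Few turns are bounded directly; many turns through their complement in the total `2π`.
  · rcases Nat.lt_or_ge J (n / 2) with h | h
    · have : (J : ℝ) + 1 ≤ (n / 2 : ℕ) := by exact_mod_cast h
      nlinarith
    · have : (n : ℝ) ≤ J + (n / 2 : ℕ) + 1 := by exact_mod_cast (by omega : n ≤ J + n / 2 + 1)
      nlinarith
  · rcases Nat.lt_or_ge J (n / 2 + 2) with h | h
    · have : (J : ℝ) ≤ (n / 2 : ℕ) + 1 := by exact_mod_cast (by omega : J ≤ n / 2 + 1)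
      nlinarith
    · have : (n : ℝ) + 1 ≤ J + (n / 2 : ℕ) := by exact_mod_cast (by omega : n + 1 ≤ J + n / 2)
      nlinarith

end Polygon

end

/-! ### Hairpins: the flattened triangle and dart -/

section

open Complex Filter Topology

/-- A simple closed counterclockwise polygonal curve without straight angles, starting with a left
turn and whose first `J` turns add up to at least `J * π - ε`. -/
structure IsHairpin (n J : ℕ) (ε : ℝ) (v : ℕ → ℂ) : Prop where
  simple : SimpleClosed n v
  area_pos : 0 < doubleArea n v
  cross_ne : ∀ k, crossAt v k ≠ 0
  cross_pos : 0 < crossAt v 0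
  le_sum : J * Real.pi - ε ≤ ∑ k ∈ Finset.range J, turnAt v k

/-- On the closed upper half plane `arg` is continuous at the negative reals, with value `π`. -/
theorem eventually_lt_arg {f : ℝ → ℂ} (hf : ContinuousAt f 0) (hre : (f 0).re < 0)
    (him : (f 0).im = 0) (hpos : ∀ x > 0, 0 ≤ (f x).im) {η : ℝ} (hη : 0 < η) :
    ∀ᶠ x in 𝓝[>] (0 : ℝ), Real.pi - η < arg (f x) := by
  have h1 : Tendsto f (𝓝[>] 0) (𝓝[{z | 0 ≤ z.im}] (f 0)) :=
    tendsto_nhdsWithin_iff.2 ⟨hf.tendsto.mono_left nhdsWithin_le_nhds,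
      eventually_nhdsWithin_of_forall hpos⟩
  have h2 := (continuousWithinAt_arg_of_re_neg_of_im_zero hre him).tendsto.comp h1
  rw [arg_eq_pi_iff.2 ⟨hre, him⟩] at h2
  exact h2.eventually_const_lt (by linarith)

theorem closeUp_crossAt_ne {N : ℕ} {f : ℕ → ℂ} (hN : 0 < N)
    (h : ∀ k < N, crossAt (closeUp N f) k ≠ 0) (k : ℕ) : crossAt (closeUp N f) k ≠ 0 := by
  have : crossAt (closeUp N f) k = crossAt (closeUp N f) (k % N) := by
    simp [crossAt, closeUp]
  rw [this]
  exact h _ (Nat.mod_lt _ hN)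

/-- The point with real part `a` and imaginary part `κ * b`, for `p = (a, b)`. -/
def squash (κ : ℝ) (p : ℝ × ℝ) : ℂ := ⟨p.1, κ * p.2⟩

theorem edgePoint_squash (κ : ℝ) (x : ℕ → ℝ × ℝ) (N i : ℕ) (s : ℝ) :
    edgePoint (closeUp N fun k => squash κ (x k)) i s =
      squash κ ((x (i % N)).1 + s * ((x ((i + 1) % N)).1 - (x (i % N)).1),
        (x (i % N)).2 + s * ((x ((i + 1) % N)).2 - (x (i % N)).2)) := by
  apply Complex.ext
  · simp [edgePoint, closeUp, squash]
  · simp [edgePoint, closeUp, squash]; ring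

theorem squash_inj {κ : ℝ} (hκ : κ ≠ 0) {p q : ℝ × ℝ} (h : squash κ p = squash κ q) :
    p.1 = q.1 ∧ p.2 = q.2 := by
  simpa [squash, hκ] using h

/-- In the limit `κ → 0` the vectors become horizontal and opposite; `him` makes the quotient
approach the negative axis from above, so the turn tends to `π` and not to `-π`. -/
theorem eventually_lt_arg_squash {p q : ℝ × ℝ} (hre : q.1 * p.1 < 0)
    (him : 0 ≤ p.1 * q.2 - p.2 * q.1) {η : ℝ} (hη : 0 < η) :
    ∀ᶠ κ in 𝓝[>] (0 : ℝ), Real.pi - η < arg (squash κ q / squash κ p) := by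
  have hp : p.1 ≠ 0 := right_ne_zero_of_mul hre.ne
  refine eventually_lt_arg (ContinuousAt.div ?_ ?_ ?_) ?_ ?_ (fun κ hκ => ?_) hη
  · simp only [squash, mk_eq_add_mul_I]; fun_prop
  · simp only [squash, mk_eq_add_mul_I]; fun_prop
  · exact fun h => hp (congrArg re h)
  · have : q.1 * p.1 / (p.1 * p.1) < 0 := div_neg_of_neg_of_pos hre (mul_self_pos.2 hp)
    simpa [squash, div_re, normSq] using this
  · simp [squash, div_im]
  · change 0 ≤ (squash κ q / squash κ p).im
    rw [im_div_eq_cross]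
    refine div_nonneg ?_ (normSq_nonneg _)
    have : 0 ≤ κ * (p.1 * q.2 - p.2 * q.1) := mul_nonneg hκ.le him
    simp only [squash, cross]
    linarith

/-- The vertices of a triangle with two turns that become `π` when it is flattened. -/
def flatTriangle : ℕ → ℝ × ℝ
  | 0 => (1, 1)
  | 1 => (0, 0)
  | _ => (2, 0)

/-- The vertices of a dart with three turns that become `π` when it is flattened. -/
def flatDart : ℕ → ℝ × ℝ
  | 0 => (3, 1)
  | 1 => (0, 0)
  | 2 => (4, 0)
  | _ => (2, 4)

theorem exists_hairpin_three {ε : ℝ} (hε : 0 < ε) : ∃ v, IsHairpin 3 2 ε v := by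
  have h0 : ∀ᶠ κ in 𝓝[>] (0 : ℝ), 0 < κ := self_mem_nhdsWithin
  have h1 := eventually_lt_arg_squash (p := (-1, -1)) (q := (2, 0)) (by norm_num) (by norm_num)
    (half_pos hε)
  have h2 := eventually_lt_arg_squash (p := (2, 0)) (q := (-1, 1)) (by norm_num) (by norm_num)
    (half_pos hε)
  obtain ⟨κ, hκ, hk1, hk2⟩ := (h0.and (h1.and h2)).exists
  refine ⟨closeUp 3 fun k => squash κ (flatTriangle k), ?_, ?_, ?_, ?_, ?_⟩
  · refine simpleClosed_of_lt (by omega) (closeUp_periodic _ _)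
      fun i j s t hij hj hs hs' ht ht' he => ?_
    rw [edgePoint_squash, edgePoint_squash] at he
    obtain ⟨ha, hb⟩ := squash_inj hκ.ne' he
    interval_cases j <;> interval_cases i <;> norm_num [flatTriangle] at ha hb ⊢ <;> linarith
  · simp [doubleArea, Finset.sum_range_succ, closeUp, squash, cross, flatTriangle]
    linarith
  · refine closeUp_crossAt_ne (by omega) fun k hk => ?_
    interval_cases k <;>
      simp [crossAt, closeUp, squash, cross, flatTriangle] <;> nlinarith
  · simp [crossAt, closeUp, squash, cross, flatTriangle]
    linarith
  · simp only [Finset.sum_range_succ, Finset.sum_range_zero, turnAt, closeUp, flatTriangle]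
    norm_num
    have e1 : squash κ (2, 0) - squash κ (0, 0) = squash κ (2, 0) := by
      simp [squash, Complex.ext_iff]
    have e2 : squash κ (0, 0) - squash κ (1, 1) = squash κ (-1, -1) := by
      simp [squash, Complex.ext_iff]
    have e3 : squash κ (1, 1) - squash κ (2, 0) = squash κ (-1, 1) := by
      simp [squash, Complex.ext_iff]; norm_num
    rw [e1, e2, e3]
    linarith

theorem exists_hairpin_four {ε : ℝ} (hε : 0 < ε) : ∃ v, IsHairpin 4 3 ε v := by
  have h0 : ∀ᶠ κ in 𝓝[>] (0 : ℝ), 0 < κ := self_mem_nhdsWithin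
  have h1 := eventually_lt_arg_squash (p := (-3, -1)) (q := (4, 0)) (by norm_num) (by norm_num)
    (div_pos hε three_pos)
  have h2 := eventually_lt_arg_squash (p := (4, 0)) (q := (-2, 4)) (by norm_num) (by norm_num)
    (div_pos hε three_pos)
  have h3 := eventually_lt_arg_squash (p := (-2, 4)) (q := (1, -3)) (by norm_num) (by norm_num)
    (div_pos hε three_pos)
  obtain ⟨κ, hκ, hk1, hk2, hk3⟩ := (h0.and (h1.and (h2.and h3))).exists
  refine ⟨closeUp 4 fun k => squash κ (flatDart k), ?_, ?_, ?_, ?_, ?_⟩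
  · refine simpleClosed_of_lt (by omega) (closeUp_periodic _ _)
      fun i j s t hij hj hs hs' ht ht' he => ?_
    rw [edgePoint_squash, edgePoint_squash] at he
    obtain ⟨ha, hb⟩ := squash_inj hκ.ne' he
    interval_cases j <;> interval_cases i <;> norm_num [flatDart] at ha hb ⊢ <;> linarith
  · simp [doubleArea, Finset.sum_range_succ, closeUp, squash, cross, flatDart]
    linarith
  · refine closeUp_crossAt_ne (by omega) fun k hk => ?_
    interval_cases k <;>
      simp [crossAt, closeUp, squash, cross, flatDart] <;> nlinarith
  · simp [crossAt, closeUp, squash, cross, flatDart]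
    linarith
  · simp only [Finset.sum_range_succ, Finset.sum_range_zero, turnAt, closeUp, flatDart]
    norm_num
    have e1 : squash κ (4, 0) - squash κ (0, 0) = squash κ (4, 0) := by
      simp [squash, Complex.ext_iff]
    have e2 : squash κ (0, 0) - squash κ (3, 1) = squash κ (-3, -1) := by
      simp [squash, Complex.ext_iff]
    have e3 : squash κ (2, 4) - squash κ (4, 0) = squash κ (-2, 4) := by
      simp [squash, Complex.ext_iff]; norm_num
    have e4 : squash κ (3, 1) - squash κ (2, 4) = squash κ (1, -3) := by
      simp [squash, Complex.ext_iff]; constructor <;> linarith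
    rw [e1, e2, e3, e4]
    linarith

end

/-! ### Attaching a spike: the curve stays simple -/

section

open Complex Filter Topology

/-- The edges `2, …, n - 1` are those that avoid `v 1`; by compactness they keep a positive distance
from it, which leaves room for a small spike. -/
theorem SimpleClosed.exists_dist_le {n : ℕ} {v : ℕ → ℂ} (h : SimpleClosed n v) (hn : 2 ≤ n) :
    ∃ r > 0, ∀ k s, k + 3 ≤ n → 0 ≤ s → s ≤ 1 → r ≤ ‖edgePoint v (k + 2) s - v 1‖ := by
  have hne : ∀ k s, k + 3 ≤ n → 0 ≤ s → s ≤ 1 → 0 < ‖edgePoint v (k + 2) s - v 1‖ := by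
    intro k s hk hs hs1
    rw [norm_pos_iff, sub_ne_zero]
    intro he
    rcases hs1.lt_or_eq with hlt | rfl
    · exact not_modEq_of_lt (n := n) (show 1 < k + 2 by omega) (by omega)
        (h.inj _ 1 s 0 hs hlt le_rfl one_pos (by simpa using he)).1.symm
    · rw [edgePoint_one] at he
      rcases hk.lt_or_eq with hk | hk
      · exact not_modEq_of_lt (n := n) (show 1 < k + 3 by omega) hk (h.vertex_inj he).symm
      · rw [show k + 2 + 1 = 0 + n by omega, h.periodic] at he
        exact not_modEq_succ hn 0 (h.vertex_inj he)
  have hmin : ∀ k, ∃ r > 0, k + 3 ≤ n → ∀ s : ℝ, 0 ≤ s → s ≤ 1 →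
      r ≤ ‖edgePoint v (k + 2) s - v 1‖ := by
    intro k
    by_cases hk : k + 3 ≤ n
    · have hc : ContinuousOn (fun s : ℝ => ‖edgePoint v (k + 2) s - v 1‖) (Set.Icc 0 1) := by
        simp only [edgePoint]; fun_prop
      obtain ⟨s, hs, hsmin⟩ := isCompact_Icc.exists_isMinOn ⟨0, by simp⟩ hc
      exact ⟨_, hne k s hk hs.1 hs.2, fun _ t ht ht1 => hsmin ⟨ht, ht1⟩⟩
    · exact ⟨1, one_pos, fun h => absurd h hk⟩
  choose r hr hrk using hmin
  obtain ⟨k, -, hk⟩ := (Finset.range (n + 1)).exists_min_image r ⟨0, by simp⟩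
  exact ⟨r k, hr k, fun j s hj hs hs1 =>
    (hk j (Finset.mem_range.2 (by omega))).trans (hrk j hj s hs hs1)⟩

/-- The vertices of the curve `v` with a spike attached to its edge `v 0, v 1` near `v 1`; the two
new vertices come first. -/
noncomputable def spike (v : ℕ → ℂ) (κ δ : ℝ) : ℕ → ℂ
  | 0 => v 1 - δ * (v 1 - v 0)
  | 1 => v 1 - δ * (2 + κ * I) * (v 1 - v 0)
  | k + 2 => v (k + 1)

section Spike

variable {n : ℕ} {v : ℕ → ℂ} {κ δ : ℝ}

theorem edgePoint_spike_zero (s : ℝ) : edgePoint (spike v κ δ) 0 s =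
    v 1 + (v 1 - v 0) * (-δ * (1 + s * (1 + κ * I))) := by
  simp only [edgePoint, spike]
  ring

theorem edgePoint_spike_one (s : ℝ) : edgePoint (spike v κ δ) 1 s =
    v 1 + (v 1 - v 0) * (-δ * (1 - s) * (2 + κ * I)) := by
  simp only [edgePoint, spike, zero_add]
  ring

theorem edgePoint_closeUp {N i : ℕ} (f : ℕ → ℂ) (hi : i + 1 < N) (s : ℝ) :
    edgePoint (closeUp N f) i s = edgePoint f i s := by
  rw [edgePoint, closeUp_of_lt f (by omega), closeUp_of_lt f hi, edgePoint]

theorem edgePoint_spike_last (hv : v (n + 1) = v 0) (s : ℝ) :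
    edgePoint (closeUp (n + 3) (spike v κ δ)) (n + 2) s = edgePoint v 0 (s * (1 - δ)) := by
  rw [edgePoint, closeUp_of_lt _ (by omega), closeUp_self, edgePoint]
  simp only [spike, hv]
  push_cast
  ring

/-- In the coordinate `z` along the edge `v 0, v 1`, the spike lies to the right of that edge or
behind `v 1`, while edge `1` leaves to the left. All later edges before the return to `v 0` are at
distance at least `r`. -/
theorem spike_edge_ne_old (h : SimpleClosed (n + 1) v) (hn : 1 ≤ n) (hpos : 0 < crossAt v 0)
    {r : ℝ} (hr : ∀ k s, k + 3 ≤ n + 1 → 0 ≤ s → s ≤ 1 → r ≤ ‖edgePoint v (k + 2) s - v 1‖)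
    {z : ℂ} (hz0 : z ≠ 0) (hz : z.im < 0 ∨ (z.im = 0 ∧ z.re < 0)) (hzr : ‖v 1 - v 0‖ * ‖z‖ < r)
    {k : ℕ} {t : ℝ} (hk : k + 2 ≤ n + 1) (ht : 0 ≤ t) (ht1 : t < 1) :
    v 1 + (v 1 - v 0) * z ≠ edgePoint v (k + 1) t := by
  intro he
  rcases k with _ | k
  · have h0 := h.edge_ne_zero (Nat.succ_le_succ hn) 0
    rw [crossAt, ← im_div_pos_iff h0] at hpos
    simp only [zero_add] at hpos h0 he
    set q := (v 2 - v 1) / (v 1 - v 0) with hq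
    have hq2 : v 2 - v 1 = (v 1 - v 0) * q := (mul_div_cancel₀ _ h0).symm
    rw [edgePoint, hq2, mul_left_comm, add_right_inj] at he
    have hzq := mul_left_cancel₀ h0 he
    rw [hzq, im_ofReal_mul, re_ofReal_mul] at hz
    rcases ht.lt_or_eq with ht0 | rfl
    · have := mul_pos ht0 hpos
      rcases hz with hz | ⟨hz, -⟩ <;> linarith
    · exact hz0 (by rw [hzq]; simp)
  · have := hr k t hk ht ht1.le
    rw [show k + 2 = k + 1 + 1 from rfl, ← he, add_sub_cancel_left, norm_mul] at this
    linarith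

theorem norm_le_abs_add (x y : ℝ) : ‖(x + y * I : ℂ)‖ ≤ |x| + |y| := by
  refine (norm_add_le _ _).trans ?_
  simp

theorem simpleClosed_spike (h : SimpleClosed (n + 1) v) (hn : 2 ≤ n) (hpos : 0 < crossAt v 0)
    {r : ℝ} (hr : ∀ k s, k + 3 ≤ n + 1 → 0 ≤ s → s ≤ 1 → r ≤ ‖edgePoint v (k + 2) s - v 1‖)
    (hκ : 0 < κ) (hκ1 : κ ≤ 1) (hδ : 0 < δ) (hδ1 : δ < 1) (hδr : ‖v 1 - v 0‖ * (3 * δ) < r) :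
    SimpleClosed (n + 3) (closeUp (n + 3) (spike v κ δ)) := by
  have hv : v (n + 1) = v 0 := by simpa using h.periodic 0
  have h0 : v 1 - v 0 ≠ 0 := h.edge_ne_zero (by omega) 0
  set f := closeUp (n + 3) (spike v κ δ) with hf
  have f0 : ∀ s, edgePoint f 0 s = v 1 + (v 1 - v 0) * (-δ * (1 + s * (1 + κ * I))) :=
    fun s => by rw [hf, edgePoint_closeUp _ (by omega), edgePoint_spike_zero]
  have f1 : ∀ s, edgePoint f 1 s = v 1 + (v 1 - v 0) * (-δ * (1 - s) * (2 + κ * I)) :=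
    fun s => by rw [hf, edgePoint_closeUp _ (by omega), edgePoint_spike_one]
  have f2 : ∀ k s, k + 2 ≤ n + 1 → edgePoint f (k + 2) s = edgePoint v (k + 1) s :=
    fun k s hk => by rw [hf, edgePoint_closeUp _ (by omega)]; rfl
  have f3 : ∀ s, edgePoint f (n + 2) s = edgePoint v 0 (s * (1 - δ)) :=
    fun s => edgePoint_spike_last hv s
  -- All edges near `v 1` are written as `v 1 + (v 1 - v 0) * z`, so that intersections can be
  -- excluded by comparing real and imaginary parts of `z`.
  have f3' : ∀ s : ℝ, edgePoint f (n + 2) s =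
      v 1 + (v 1 - v 0) * (-1 + s * (1 - δ)) := fun s => by
    rw [f3, edgePoint]; push_cast; ring
  have z0re : ∀ s : ℝ, (-δ * (1 + s * (1 + κ * I)) : ℂ).re = -δ * (1 + s) := fun s => by
    simp
  have z0im : ∀ s : ℝ, (-δ * (1 + s * (1 + κ * I)) : ℂ).im = -δ * (s * κ) := fun s => by
    simp
  have z1re : ∀ s : ℝ, (-δ * (1 - s) * (2 + κ * I) : ℂ).re = -δ * (1 - s) * 2 := fun s => by
    simp
  have z1im : ∀ s : ℝ, (-δ * (1 - s) * (2 + κ * I) : ℂ).im = -δ * (1 - s) * κ := fun s => by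
    simp
  have hold : ∀ s k t, 0 ≤ s → s < 1 → 0 ≤ t → t < 1 → k + 2 ≤ n + 1 →
      edgePoint f 0 s ≠ edgePoint v (k + 1) t ∧ edgePoint f 1 s ≠ edgePoint v (k + 1) t := by
    intro s k t hs hs1 ht ht1 hk
    rw [f0, f1]
    constructor
    · have hre : (-δ * (1 + s * (1 + κ * I)) : ℂ).re < 0 := by rw [z0re]; nlinarith
      refine spike_edge_ne_old h (by omega) hpos hr (fun h0 => hre.ne (by rw [h0]; simp)) ?_ ?_ hk ht ht1
      · rcases hs.lt_or_eq with hs | rfl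
        · left
          rw [z0im]
          have := mul_pos hδ (mul_pos hs hκ)
          linarith
        · exact Or.inr ⟨by rw [z0im]; ring, hre⟩
      · refine lt_of_le_of_lt (mul_le_mul_of_nonneg_left ?_ (norm_nonneg _)) hδr
        rw [norm_mul, norm_neg, norm_real, Real.norm_of_nonneg hδ.le, mul_comm 3]
        refine mul_le_mul_of_nonneg_left ?_ hδ.le
        have := norm_le_abs_add (1 + s) (s * κ)
        rw [abs_of_nonneg (by positivity), abs_of_nonneg (by positivity)] at this
        refine le_trans (le_of_eq ?_) (this.trans (by nlinarith))
        push_cast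
        ring_nf
    · have him : (-δ * (1 - s) * (2 + κ * I) : ℂ).im < 0 := by
        rw [z1im]
        have := mul_pos (mul_pos hδ (sub_pos.2 hs1)) hκ
        linarith
      refine spike_edge_ne_old h (by omega) hpos hr (fun h0 => him.ne (by rw [h0]; simp))
        (Or.inl him) ?_ hk ht ht1
      refine lt_of_le_of_lt (mul_le_mul_of_nonneg_left ?_ (norm_nonneg _)) hδr
      have e : (-δ * (1 - s) * (2 + κ * I) : ℂ) = ((-(δ * (1 - s)) : ℝ) : ℂ) * (2 + κ * I) := by
        push_cast; ring
      have hs' : 0 ≤ 1 - s := by linarith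
      rw [e, norm_mul, norm_real, Real.norm_eq_abs, abs_neg, abs_of_nonneg (by positivity),
        mul_comm 3]
      have := norm_le_abs_add 2 κ
      rw [abs_of_nonneg (by positivity), abs_of_nonneg hκ.le] at this
      have h3 : ‖(2 + κ * I : ℂ)‖ ≤ 3 := by
        refine le_trans (le_of_eq ?_) (this.trans (by linarith))
        push_cast
        ring_nf
      refine mul_le_mul ?_ h3 (norm_nonneg _) hδ.le
      nlinarith
  refine simpleClosed_of_lt (by omega) (closeUp_periodic _ _)
    fun i j s t hij hj hs hs' ht ht' he => ?_
  rcases i with _ | _ | i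
  · rcases j with _ | _ | j
    · rw [f0, f0, add_right_inj] at he
      have := congrArg re (mul_left_cancel₀ h0 he)
      rw [z0re, z0re] at this
      have := mul_left_cancel₀ (neg_ne_zero.2 hδ.ne') this
      exact ⟨rfl, by linarith⟩
    · exfalso
      rw [zero_add, f0, f1, add_right_inj] at he
      have hz := mul_left_cancel₀ h0 he
      have h1 := congrArg re hz
      have h2 := congrArg im hz
      rw [z0re, z1re, mul_assoc] at h1
      rw [z0im, z1im, mul_assoc] at h2
      have h1 := mul_left_cancel₀ (neg_ne_zero.2 hδ.ne') h1
      have h2 := mul_right_cancel₀ hκ.ne' (mul_left_cancel₀ (neg_ne_zero.2 hδ.ne') h2)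
      linarith
    · exfalso
      rcases Nat.lt_or_ge j n with hjn | hjn
      · rw [f2 j t (by omega)] at he
        exact (hold s j t hs hs' ht ht' (by omega)).1 he
      · obtain rfl : j = n := by omega
        rw [f0, f3', add_right_inj] at he
        have hz := mul_left_cancel₀ h0 he
        have h1 := congrArg re hz
        have h2 := congrArg im hz
        rw [z0re] at h1
        rw [z0im] at h2
        simp at h1 h2
        have hs0 : s = 0 := by
          rcases h2 with h2 | h2 | h2
          · exact absurd h2 hδ.ne'
          · exact h2
          · exact absurd h2 hκ.ne'
        subst hs0
        nlinarith
  · rcases j with _ | _ | j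
    · omega
    · rw [zero_add, f1, f1, add_right_inj] at he
      have := congrArg re (mul_left_cancel₀ h0 he)
      rw [z1re, z1re, mul_assoc, mul_assoc] at this
      have := mul_left_cancel₀ (neg_ne_zero.2 hδ.ne') this
      exact ⟨rfl, by linarith⟩
    · exfalso
      rcases Nat.lt_or_ge j n with hjn | hjn
      · rw [f2 j t (by omega)] at he
        exact (hold s j t hs hs' ht ht' (by omega)).2 he
      · obtain rfl : j = n := by omega
        rw [zero_add, f1, f3', add_right_inj] at he
        have h2 := congrArg im (mul_left_cancel₀ h0 he)
        rw [z1im] at h2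
        have := mul_pos (mul_pos hδ (sub_pos.2 hs')) hκ
        simp at h2
        rcases h2 with (h2 | h2) | h2 <;> linarith
  · obtain ⟨j, rfl⟩ : ∃ l, j = l + 2 := ⟨j - 2, by omega⟩
    rcases Nat.lt_or_ge j n with hjn | hjn
    · rw [f2 i s (by omega), f2 j t (by omega)] at he
      have := h.inj _ _ s t hs hs' ht ht' he
      have h1 := this.1
      rw [Nat.ModEq, Nat.mod_eq_of_lt (by omega), Nat.mod_eq_of_lt (by omega)] at h1
      exact ⟨by omega, this.2⟩
    · obtain rfl : j = n := by omega
      have ht2 : t * (1 - δ) < 1 := by nlinarith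
      have ht0 : 0 ≤ t * (1 - δ) := mul_nonneg ht (by linarith)
      rcases Nat.lt_or_ge i j with hin | hin
      · exfalso
        rw [f2 i s (by omega), f3] at he
        exact SimpleClosed.not_modEq_of_lt (n := j + 1) (show 0 < i + 1 by omega) (by omega)
          (h.inj _ _ s _ hs hs' ht0 ht2 he).1.symm
      · obtain rfl : i = j := by omega
        rw [f3', f3', add_right_inj] at he
        have := congrArg re (mul_left_cancel₀ h0 he)
        simp at this
        refine ⟨rfl, ?_⟩
        rcases this with h1 | h1
        · exact h1
        · linarith

end Spike

end

/-! ### Attaching a spike: area, turns and induction -/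

section

open Complex Filter Topology

theorem cross_mul_mul (a b e : ℂ) : cross (a * e) (b * e) = cross a b * normSq e := by
  simp only [cross, mul_re, mul_im, normSq_apply]; ring

section Spike

variable {n : ℕ} {v : ℕ → ℂ} {κ δ : ℝ}

theorem spike_edge_zero : spike v κ δ 1 - spike v κ δ 0 =
    ((-δ : ℝ) * (1 + κ * I)) * (v 1 - v 0) := by
  simp only [spike]; push_cast; ring

theorem spike_edge_one : spike v κ δ 2 - spike v κ δ 1 = ((δ : ℝ) * (2 + κ * I)) * (v 1 - v 0) := by
  simp only [spike]; push_cast; ring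

theorem cross_spike_edges : cross (spike v κ δ 1 - spike v κ δ 0) (spike v κ δ 2 - spike v κ δ 1) =
    δ * δ * κ * normSq (v 1 - v 0) := by
  rw [spike_edge_zero, spike_edge_one, cross_mul_mul]
  congr 1
  simp [cross]
  ring

theorem doubleArea_spike (hv : v (n + 1) = v 0) :
    doubleArea (n + 3) (closeUp (n + 3) (spike v κ δ)) =
      doubleArea (n + 1) v + δ * δ * κ * normSq (v 1 - v 0) := by
  rw [doubleArea_closeUp, Finset.sum_range_succ', Finset.sum_range_succ', doubleArea,
    Finset.sum_range_succ', ← cross_spike_edges]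
  have h : ∀ k, spike v κ δ (k + 1 + 1) = v (k + 1) := fun k => rfl
  simp only [h, hv, zero_add, Nat.reduceAdd]
  simp only [spike, cross, sub_re, sub_im, mul_assoc, re_ofReal_mul, im_ofReal_mul]
  ring

/-- Only the corners at the two new vertices and at `v 1` need an argument. At `v 1` the cross
product is a positive multiple of `2 * q.im - κ * q.re`, which is what `hq` controls. -/
theorem crossAt_spike_ne (h : SimpleClosed (n + 1) v) (hn : 1 ≤ n) (hc : ∀ k, crossAt v k ≠ 0)
    (hκ : 0 < κ) (hδ : 0 < δ) (hδ1 : δ < 1)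
    (hq : κ * ((v 2 - v 1) / (v 1 - v 0)).re < 2 * ((v 2 - v 1) / (v 1 - v 0)).im) (k : ℕ) :
    crossAt (closeUp (n + 3) (spike v κ δ)) k ≠ 0 := by
  have hv : v (n + 1) = v 0 := by simpa using h.periodic 0
  have hv1 : v (n + 2) = v 1 := by rw [← h.periodic 1]; congr 1; ring
  have h0 : v 1 - v 0 ≠ 0 := h.edge_ne_zero (by omega) 0
  have hN : 0 < normSq (v 1 - v 0) := normSq_pos.2 h0
  have hlast : spike v κ δ 0 - v 0 = ((1 - δ : ℝ) : ℂ) * (v 1 - v 0) := by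
    simp only [spike]; push_cast; ring
  have hδ1' : 0 < 1 - δ := by linarith
  refine closeUp_crossAt_ne (by omega) (fun k hk => ?_) k
  rcases k with _ | _ | k
  · rw [crossAt, closeUp_of_lt _ (by omega), closeUp_of_lt _ (by omega), closeUp_of_lt _ (by omega),
      zero_add, cross_spike_edges]
    positivity
  · rw [crossAt, closeUp_of_lt _ (by omega), closeUp_of_lt _ (by omega), closeUp_of_lt _ (by omega)]
    simp only [zero_add, Nat.reduceAdd]
    have h3 : spike v κ δ 3 - spike v κ δ 2 = (v 2 - v 1) / (v 1 - v 0) * (v 1 - v 0) := by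
      rw [div_mul_cancel₀ _ h0]; rfl
    rw [spike_edge_one, h3, cross_mul_mul]
    refine mul_ne_zero ?_ hN.ne'
    set q := (v 2 - v 1) / (v 1 - v 0)
    have : cross (δ * (2 + κ * I)) q = δ * (2 * q.im - κ * q.re) := by
      simp [cross]; ring
    rw [this]
    have : 0 < 2 * q.im - κ * q.re := by linarith
    positivity
  · rcases Nat.lt_trichotomy (k + 1) n with hkn | hkn | hkn
    · rw [crossAt, closeUp_of_lt _ (by omega), closeUp_of_lt _ (by omega),
        closeUp_of_lt _ (by omega)]
      exact hc (k + 1)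
    · have h3 : closeUp (n + 3) (spike v κ δ) (k + 1 + 1 + 2) = spike v κ δ 0 := by
        rw [show k + 1 + 1 + 2 = n + 3 by omega, closeUp_self]
      rw [crossAt, closeUp_of_lt _ (by omega), closeUp_of_lt _ (by omega), h3]
      have h1 : spike v κ δ (k + 2) = v n := by rw [← hkn]; rfl
      have h2 : spike v κ δ (k + 2 + 1) = v (n + 1) := by rw [← hkn]; rfl
      rw [h1, h2]
      have := hc n
      rw [crossAt, hv1] at this
      rw [hv] at this ⊢
      rw [hlast]
      have e : cross (v 0 - v n) (((1 - δ : ℝ) : ℂ) * (v 1 - v 0)) =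
          (1 - δ) * cross (v 0 - v n) (v 1 - v 0) := by
        simp only [cross, re_ofReal_mul, im_ofReal_mul]; ring
      rw [e]
      exact mul_ne_zero hδ1'.ne' this
    · obtain rfl : k = n := by omega
      have h1 : spike v κ δ (k + 2) = v 0 := by rw [← hv]; rfl
      have h2 : closeUp (k + 3) (spike v κ δ) (k + 1 + 1 + 1) = spike v κ δ 0 := closeUp_self _ _
      have h3 : closeUp (k + 3) (spike v κ δ) (k + 1 + 1 + 2) = spike v κ δ 1 := by
        rw [show k + 1 + 1 + 2 = 1 + (k + 3) by ring, closeUp_periodic, closeUp_of_lt _ (by omega)]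
      rw [crossAt, h2, h3, closeUp_of_lt _ (by omega), h1, hlast, spike_edge_zero, cross_mul_mul]
      refine mul_ne_zero ?_ hN.ne'
      have : cross ((1 - δ : ℝ) : ℂ) ((-δ : ℝ) * (1 + κ * I)) = -((1 - δ) * δ * κ) := by
        simp [cross]
        ring
      rw [this]
      exact neg_ne_zero.2 (by positivity)

end Spike

theorem arg_ofReal_mul_div_ofReal_mul {a b : ℝ} (ha : 0 < a) (hb : 0 < b) (z w : ℂ) :
    arg ((a * z) / (b * w)) = arg (z / w) := by
  rw [mul_div_mul_comm, ← ofReal_div, arg_real_mul _ (div_pos ha hb)]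

/-- The tip of the spike contributes a turn close to `π`, and the turn at `v 1` changes little; both
now precede the old run. The compensating right turn is at the base of the spike, vertex `0`, and is
not among the counted ones. -/
theorem IsHairpin.exists_extend {n J : ℕ} {ε η : ℝ} {v : ℕ → ℂ} (hv : IsHairpin (n + 1) (J + 1) ε v)
    (hn : 2 ≤ n) (hJ : J + 1 ≤ n) (hη : 0 < η) : ∃ w, IsHairpin (n + 3) (J + 2) (ε + η) w := by
  obtain ⟨r, hr0, hr⟩ := hv.simple.exists_dist_le (by omega)
  have h0 : v 1 - v 0 ≠ 0 := hv.simple.edge_ne_zero (by omega) 0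
  set q := (v 2 - v 1) / (v 1 - v 0) with hq
  have hqim : 0 < q.im := (im_div_pos_iff h0 _).2 hv.cross_pos
  have e1 : ∀ᶠ κ in 𝓝[>] (0 : ℝ), 0 < κ := self_mem_nhdsWithin
  have e2 : ∀ᶠ κ in 𝓝[>] (0 : ℝ), κ < 1 :=
    (eventually_lt_nhds one_pos).filter_mono nhdsWithin_le_nhds
  have e3 : ∀ᶠ κ in 𝓝[>] (0 : ℝ), κ * q.re < 2 * q.im := by
    refine Eventually.filter_mono nhdsWithin_le_nhds ?_
    have : ContinuousAt (fun κ : ℝ => κ * q.re) 0 := by fun_prop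
    exact this.eventually_lt_const (by simpa using hqim)
  have e4 := eventually_lt_arg_squash (p := (-1, -1)) (q := (2, 1)) (by norm_num) (by norm_num)
    (half_pos hη)
  have e5 : ∀ᶠ κ : ℝ in 𝓝[>] 0, arg q - η / 2 < arg (q / (2 + κ * I)) := by
    refine Eventually.filter_mono nhdsWithin_le_nhds ?_
    have hq2 : arg (q / (2 + (0 : ℝ) * I)) = arg q := by
      rw [ofReal_zero, zero_mul, add_zero, div_eq_mul_inv,
        show (2 : ℂ)⁻¹ = ((2⁻¹ : ℝ) : ℂ) by push_cast; rfl, arg_mul_real (by norm_num)]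
    have hslit : q / (2 + (0 : ℝ) * I) ∈ slitPlane := by
      rw [mem_slitPlane_iff]
      right
      simpa using hqim.ne'
    have hc : ContinuousAt (fun κ : ℝ => arg (q / (2 + κ * I))) 0 :=
      ContinuousAt.comp (f := fun κ : ℝ => q / (2 + κ * I)) (continuousAt_arg hslit)
        (ContinuousAt.div (by fun_prop) (by fun_prop) (by simp))
    exact hc.eventually_const_lt (by simp only [hq2]; linarith)
  -- The turns at the tip and at `v 1` depend on `κ` only; `δ`, chosen afterwards, just makes the
  -- spike small enough to avoid the rest.
  obtain ⟨κ, hκ, hκ1, hκq, ha, hb⟩ := (e1.and (e2.and (e3.and (e4.and e5)))).exists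
  obtain ⟨δ, hδ, hδ1, hδr⟩ : ∃ δ > 0, δ < 1 ∧ ‖v 1 - v 0‖ * (3 * δ) < r := by
    have d1 : ∀ᶠ δ in 𝓝[>] (0 : ℝ), 0 < δ := self_mem_nhdsWithin
    have d2 : ∀ᶠ δ in 𝓝[>] (0 : ℝ), δ < 1 :=
      (eventually_lt_nhds one_pos).filter_mono nhdsWithin_le_nhds
    have d3 : ∀ᶠ δ in 𝓝[>] (0 : ℝ), ‖v 1 - v 0‖ * (3 * δ) < r := by
      refine Eventually.filter_mono nhdsWithin_le_nhds ?_
      have : ContinuousAt (fun δ : ℝ => ‖v 1 - v 0‖ * (3 * δ)) 0 := by fun_prop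
      exact this.eventually_lt_const (by simpa using hr0)
    obtain ⟨δ, h1, h2, h3⟩ := (d1.and (d2.and d3)).exists
    exact ⟨δ, h1, h2, h3⟩
  have hv0 : v (n + 1) = v 0 := by simpa using hv.simple.periodic 0
  have hN : 0 < normSq (v 1 - v 0) := normSq_pos.2 h0
  refine ⟨closeUp (n + 3) (spike v κ δ), simpleClosed_spike hv.simple hn hv.cross_pos hr hκ hκ1.le
    hδ hδ1 hδr, ?_, crossAt_spike_ne hv.simple (by omega) hv.cross_ne hκ hδ hδ1 hκq, ?_, ?_⟩
  · rw [doubleArea_spike hv0]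
    have := hv.area_pos
    positivity
  · rw [crossAt, closeUp_of_lt _ (by omega), closeUp_of_lt _ (by omega), closeUp_of_lt _ (by omega),
      zero_add, zero_add, cross_spike_edges]
    positivity
  · have t0 : turnAt (closeUp (n + 3) (spike v κ δ)) 0 = arg (squash κ (2, 1) / squash κ (-1, -1)) := by
      rw [turnAt, closeUp_of_lt _ (by omega), closeUp_of_lt _ (by omega),
        closeUp_of_lt _ (by omega), zero_add, zero_add, spike_edge_one, spike_edge_zero,
        mul_div_mul_right _ _ h0, ofReal_neg, neg_mul, ← mul_neg,
        arg_ofReal_mul_div_ofReal_mul hδ hδ]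
      congr 2 <;> apply Complex.ext <;> simp [squash]
    have t1 : turnAt (closeUp (n + 3) (spike v κ δ)) 1 = arg (q / (2 + κ * I)) := by
      rw [turnAt, closeUp_of_lt _ (by omega), closeUp_of_lt _ (by omega),
        closeUp_of_lt _ (by omega)]
      simp only [Nat.reduceAdd]
      have h3 : spike v κ δ 3 - spike v κ δ 2 = ((1 : ℝ) * q) * (v 1 - v 0) := by
        rw [ofReal_one, one_mul, hq, div_mul_cancel₀ _ h0]; rfl
      rw [h3, spike_edge_one, mul_div_mul_right _ _ h0, arg_ofReal_mul_div_ofReal_mul one_pos hδ]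
    have t2 : ∀ k ∈ Finset.range J, turnAt (closeUp (n + 3) (spike v κ δ)) (k + 1 + 1) =
        turnAt v (k + 1) := by
      intro k hk
      have hk := Finset.mem_range.1 hk
      rw [turnAt, closeUp_of_lt _ (by omega), closeUp_of_lt _ (by omega),
        closeUp_of_lt _ (by omega)]
      rfl
    have hq0 : turnAt v 0 = arg q := rfl
    have hsum := hv.le_sum
    rw [Finset.sum_range_succ', hq0] at hsum
    rw [Finset.sum_range_succ', Finset.sum_range_succ', Finset.sum_congr rfl t2, zero_add, t0, t1]
    push_cast at hsum ⊢
    linarith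

theorem exists_hairpin {m : ℕ} (hm : 3 ≤ m) {ε : ℝ} (hε : 0 < ε) :
    ∃ v, IsHairpin m (m / 2 + 1) ε v := by
  induction m using Nat.strong_induction_on generalizing ε with
  | _ m ih =>
  rcases Nat.lt_or_ge m 5 with h5 | h5
  · interval_cases m
    · exact exists_hairpin_three hε
    · exact exists_hairpin_four hε
  · obtain ⟨n, rfl⟩ := Nat.exists_eq_add_of_le' (show 3 ≤ m by omega)
    obtain ⟨v, hv⟩ := ih (n + 1) (by omega) (by omega) (half_pos hε)
    obtain ⟨w, hw⟩ := hv.exists_extend (by omega) (by omega) (half_pos hε)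
    refine ⟨w, ?_⟩
    rw [add_halves] at hw
    rwa [show (n + 3) / 2 + 1 = (n + 1) / 2 + 2 by omega]

end

/-! ### From vertex sequences to polygons; the theorem -/

open Complex

/-- The polygon whose vertices are the first `m` terms of a sequence. -/
def polygonOf (m : ℕ) (v : ℕ → ℂ) : Polygon ℂ m := ⟨fun i => v i.val⟩

theorem polygonOf_vertexAt {m : ℕ} [NeZero m] {v : ℕ → ℂ} (h : SimpleClosed m v) :
    (polygonOf m v).vertexAt = v := by
  funext k
  exact h.apply_mod k

theorem edgePoint_const_mul (c : ℂ) (v : ℕ → ℂ) (i : ℕ) (s : ℝ) :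
    edgePoint (fun k => c * v k) i s = c * edgePoint v i s := by
  simp only [edgePoint]; ring

theorem SimpleClosed.const_mul {n : ℕ} {v : ℕ → ℂ} (h : SimpleClosed n v) {c : ℂ} (hc : c ≠ 0) :
    SimpleClosed n fun k => c * v k where
  periodic k := by rw [h.periodic]
  inj i j s t hs hs' ht ht' he := by
    rw [edgePoint_const_mul, edgePoint_const_mul] at he
    exact h.inj i j s t hs hs' ht ht' (mul_left_cancel₀ hc he)

theorem turnAt_const_mul {c : ℂ} (hc : c ≠ 0) (v : ℕ → ℂ) (k : ℕ) :
    turnAt (fun k => c * v k) k = turnAt v k := by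
  simp only [turnAt, ← mul_sub]
  rw [mul_div_mul_left _ _ hc]

theorem cross_const_mul (c z w : ℂ) : cross (c * z) (c * w) = normSq c * cross z w := by
  rw [mul_comm c z, mul_comm c w, cross_mul_mul, mul_comm]

theorem doubleArea_const_mul (c : ℂ) (n : ℕ) (v : ℕ → ℂ) :
    doubleArea n (fun k => c * v k) = normSq c * doubleArea n v := by
  simp only [doubleArea, cross_const_mul, Finset.mul_sum]

theorem affineIndependent_of_cross_ne {a b c : ℂ} (h : cross (b - a) (c - b) ≠ 0) :
    AffineIndependent ℝ ![a, b, c] := by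
  rw [affineIndependent_iff_not_collinear_set, collinear_iff_of_mem (Set.mem_insert a {b, c})]
  rintro ⟨w, hw⟩
  obtain ⟨s, hs⟩ := hw b (by simp)
  obtain ⟨t, ht⟩ := hw c (by simp)
  refine h ?_
  rw [hs, ht]
  simp only [cross, vadd_eq_add, real_smul, sub_re, sub_im, add_re, add_im, re_ofReal_mul,
    im_ofReal_mul]
  ring

namespace Polygon

variable {m : ℕ} [NeZero m]

theorem hasNondegenerateVertices_of_crossAt {P : Polygon ℂ m}
    (h : ∀ k, crossAt P.vertexAt k ≠ 0) : P.HasNondegenerateVertices ℝ := by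
  intro i
  have h1 : P (i + 1) = P.vertexAt (i.val + 1) := by
    rw [vertexAt]
    congr 1
    exact Fin.ext (by simp [Fin.ofNat, Fin.val_add])
  have h2 : P (i + 2) = P.vertexAt (i.val + 2) := by
    rw [vertexAt]
    congr 1
    exact Fin.ext (by simp [Fin.ofNat, Fin.val_add])
  rw [h1, h2, ← P.vertexAt_val i]
  exact affineIndependent_of_cross_ne (h i.val)

theorem edgeAngle_of_eq_exp {P : Polygon ℂ m} {k : ℕ} {α : ℝ} (hα : 0 ≤ α) (hα' : α < 2 * Real.pi)
    (h : P.edgeVec k = exp (α * I)) : P.edgeAngle k = α := by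
  rw [edgeAngle, h, arg_exp, im_ofReal_mul, I_im, mul_one]
  have h1 : toIocMod Real.two_pi_pos (-Real.pi) α =
      α - toIocDiv Real.two_pi_pos (-Real.pi) α • (2 * Real.pi) := rfl
  rw [h1, toIcoMod_sub_zsmul, toIcoMod_eq_self]
  exact ⟨hα, by simpa using hα'⟩

/-- At a suitable point of the tour, exactly `J` vertices have been passed. -/
theorem exists_turningFunction_eq {P : Polygon ℂ m} (hm : 3 ≤ m) (hs : P.IsSimple) {J : ℕ}
    (hJ : J + 1 < m) (i : Fin m) : ∃ x ∈ Set.Icc (0 : ℝ) 1,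
      P.turningFunction (i, ⟨0, le_rfl, one_pos⟩) x =
        P.edgeAngle i.val + ∑ j ∈ Finset.range (J + 1), P.turn (i.val + j) := by
  classical
  have h := P.isSimple_iff.1 hs
  have hpos : ∀ k, 0 < ‖P.edgeVec k‖ := fun k => norm_pos_iff.2 (h.edge_ne_zero (by omega) k)
  set p : Fin m × Set.Ico (0 : ℝ) 1 := (i, ⟨0, le_rfl, one_pos⟩) with hp
  have hdist : ∀ j, P.distToVertex p j = ∑ l ∈ Finset.range (j + 1), ‖P.edgeVec (i.val + l)‖ :=
    fun j => by simp [distToVertex, hp]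
  have hmono : StrictMono (P.distToVertex p) := by
    refine strictMono_nat_of_lt_succ fun j => ?_
    rw [hdist, hdist, Finset.sum_range_succ _ (j + 1)]
    linarith [hpos (i.val + (j + 1))]
  have hper : P.distToVertex p (m - 1) = P.perimeter := by
    have hf : ∀ k, ‖P.edgeVec (k + m)‖ = ‖P.edgeVec k‖ := fun k => by
      rw [edgeVec, edgeVec, add_right_comm, P.vertexAt_add_self, P.vertexAt_add_self]
    rw [hdist, Nat.sub_add_cancel (by omega), perimeter,
      ← sum_range_shift (f := fun k => ‖P.edgeVec k‖) hf i.val]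
    simp only [add_comm i.val]
  have hJlt : P.distToVertex p J < P.perimeter := hper ▸ hmono (by omega)
  have hJpos : 0 < P.distToVertex p J := by
    rw [hdist]
    exact Finset.sum_pos (fun l _ => hpos _) ⟨0, by simp⟩
  have hperpos := hJpos.trans hJlt
  -- The fraction at which the `J`-th vertex (counted from 0) is reached; a vertex reached exactly
  -- counts as passed.
  refine ⟨P.distToVertex p J / P.perimeter, ⟨by positivity, (div_le_one hperpos).2 hJlt.le⟩, ?_⟩
  rw [turningFunction, div_mul_cancel₀ _ hperpos.ne']
  congr 1
  refine Finset.sum_congr ?_ fun _ _ => rfl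
  ext j
  rw [Finset.mem_filter, Finset.mem_range, Finset.mem_range, hmono.le_iff_le, ← hper,
    hmono.lt_iff_lt]
  omega

end Polygon

theorem SimpleClosed.exists_polygon {m : ℕ} [NeZero m] (hm : 3 ≤ m) {v : ℕ → ℂ}
    (h : SimpleClosed m v) (hA : 0 < doubleArea m v) (hc : ∀ k, crossAt v k ≠ 0) {J : ℕ}
    (hJ : J + 1 < m) (i : Fin m) {α : ℝ} (hα : 0 ≤ α) (hα' : α < 2 * Real.pi) :
    ∃ P : Polygon ℂ m, P.IsSimple ∧ P.IsCounterclockwise ∧ P.HasNondegenerateVertices ℝ ∧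
      ∃ p : Fin m × Set.Ico (0 : ℝ) 1, ∃ x ∈ Set.Icc (0 : ℝ) 1,
        P.turningFunction p x = α + ∑ j ∈ Finset.range (J + 1), turnAt v (i.val + j) := by
  have he := h.edge_ne_zero (by omega) i.val
  -- Multiplication by `c` turns the starting edge to the angle `α` and scales it to length 1; turns
  -- and orientation are unaffected.
  set c : ℂ := exp (α * I) / (v (i.val + 1) - v i.val) with hcdef
  have hc0 : c ≠ 0 := div_ne_zero (exp_ne_zero _) he
  have hw := h.const_mul hc0
  set P := polygonOf m fun k => c * v k with hP
  have hvert : P.vertexAt = fun k => c * v k := polygonOf_vertexAt hw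
  have hsimple : P.IsSimple := P.isSimple_iff.2 (by rwa [hvert])
  have hccw : P.IsCounterclockwise := by
    rw [Polygon.IsCounterclockwise, P.signedArea_eq, hvert, doubleArea_const_mul]
    have := normSq_pos.2 hc0
    positivity
  refine ⟨P, hsimple, hccw, Polygon.hasNondegenerateVertices_of_crossAt fun k => ?_, ?_⟩
  · rw [hvert, crossAt]
    simp only [← mul_sub]
    rw [cross_const_mul]
    exact mul_ne_zero (normSq_pos.2 hc0).ne' (hc k)
  · obtain ⟨x, hx, hxe⟩ := P.exists_turningFunction_eq hm hsimple hJ i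
    refine ⟨(i, ⟨0, le_rfl, one_pos⟩), x, hx, ?_⟩
    rw [hxe, Polygon.edgeAngle_of_eq_exp hα hα']
    · congr 1
      refine Finset.sum_congr rfl fun j _ => ?_
      rw [P.turn_eq, hvert, turnAt_const_mul hc0]
    · rw [Polygon.edgeVec, hvert]
      simp only
      rw [← mul_sub, hcdef, div_mul_cancel₀ _ he]

theorem mainTheorem2 (m : ℕ) [NeZero m] (hm : 3 ≤ m) :
    (∀ P : Polygon ℂ m, P.IsSimple → P.IsCounterclockwise → P.HasNondegenerateVertices ℝ →
      ∀ p : Fin m × Set.Ico (0 : ℝ) 1, ∀ x ∈ Set.Icc (0 : ℝ) 1,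
        -(((m / 2 : ℕ) : ℝ) - 1) * Real.pi ≤ P.turningFunction p x ∧
          P.turningFunction p x ≤ (((m / 2 : ℕ) : ℝ) + 3) * Real.pi) ∧
    (∀ ε : ℝ, 0 < ε →
      (∃ P : Polygon ℂ m, P.IsSimple ∧ P.IsCounterclockwise ∧ P.HasNondegenerateVertices ℝ ∧
        ∃ p : Fin m × Set.Ico (0 : ℝ) 1, ∃ x ∈ Set.Icc (0 : ℝ) 1,
          (((m / 2 : ℕ) : ℝ) + 3) * Real.pi - ε ≤ P.turningFunction p x) ∧
      (∃ Q : Polygon ℂ m, Q.IsSimple ∧ Q.IsCounterclockwise ∧ Q.HasNondegenerateVertices ℝ ∧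
        ∃ q : Fin m × Set.Ico (0 : ℝ) 1, ∃ x ∈ Set.Icc (0 : ℝ) 1,
          Q.turningFunction q x ≤ -(((m / 2 : ℕ) : ℝ) - 1) * Real.pi + ε)) := by
  refine ⟨fun P hs hc _ p x _ => P.turningFunction_bounds hm hs hc p x, fun ε hε => ?_⟩
  obtain ⟨v, hv⟩ := exists_hairpin hm (half_pos hε)
  have hpi := Real.pi_pos
  have hle := hv.le_sum
  push_cast at hle
  constructor
  -- Half of `ε` is spent on the starting angle, half on the turns; the minimum with `π` keeps the
  -- angle nonnegative when `ε` is large.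
  · obtain ⟨P, h1, h2, h3, p, x, hx, hxe⟩ := hv.simple.exists_polygon hm hv.area_pos hv.cross_ne
      (J := m / 2) (by omega) 0 (α := 2 * Real.pi - min (ε / 2) Real.pi)
      (by linarith [min_le_right (ε / 2) Real.pi]) (by linarith [lt_min (half_pos hε) hpi])
    refine ⟨P, h1, h2, h3, p, x, hx, ?_⟩
    simp only [Fin.coe_ofNat_eq_mod, Nat.zero_mod, zero_add] at hxe
    rw [hxe]
    linarith [min_le_left (ε / 2) Real.pi]
  -- The tour starts on the edge after the run of left turns and passes the `K + 1` complementary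
  -- vertices.
  · obtain ⟨K, hK⟩ : ∃ K, m = m / 2 + 1 + (K + 1) := ⟨m - (m / 2 + 2), by omega⟩
    obtain ⟨P, h1, h2, h3, p, x, hx, hxe⟩ := hv.simple.exists_polygon hm hv.area_pos hv.cross_ne
      (J := K) (by omega) ⟨m / 2 + 1, by omega⟩ (α := 0) le_rfl (by positivity)
    refine ⟨P, h1, h2, h3, p, x, hx, ?_⟩
    have htot := hv.simple.sum_turnAt_of_doubleArea_pos hm hv.area_pos
    rw [hK, Finset.sum_range_add] at htot
    simp only at hxe
    rw [hxe]
    linarith
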